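/- **Setting.** Let $M$ be a compact (connected) Riemann surface, with its complex orientation, and let $\omega$ be a positive real smooth $2$-form on $M$; equivalently $\omega = i e^{2\sigma}h^2\,dz\wedge d\bar z$, where $h^2\,dz\otimes d\bar z$ is a conformal metric and $\sigma$ a smooth real function. Let $L\to M$ be a smooth complex line bundle with a smooth Hermitian metric $H$. Let $\mathcal A$ be the space of smooth unitary connections on $L$, an affine space over $\Omega^1(M,i\mathbb R)$; for $A\in\mathcal A$ let $F_A\in\Omega^2(M,i\mathbb R)$ be the curvature, locally $F_A=d\theta$ where $\theta$ is the connection form of $A$ in a local frame. Put $$\mathcal C=\mathcal A\times\Gamma(M,L\oplus L)\times\Omega^1(M,i\mathbb R),\qquad p=(A,\Psi,\Phi)\in\mathcal C,\quad \Psi=\begin{pmatrix}\psi_1\\ \bar\psi_2\end{pmatrix},$$ with $\psi_1,\bar\psi_2\in\Gamma(M,L)$, so that $T_p\mathcal C=\Omega^1(M,i\mathbb R)\times\Gamma(M,L\oplus L)\times\Omega^1(M,i\mathbb R)$. For $X=(\alpha_1,\beta,\gamma_1)$ and $Y=(\alpha_2,\eta,\gamma_2)$ in $T_p\mathcal C$,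 with $\beta=(\beta_1,\bar\beta_2)^T$ and $\eta=(\eta_1,\bar\eta_2)^T$, set $$\Omega(X,Y)=-\int_M\alpha_1\wedge\alpha_2+\int_M \mathrm{Re}\,\langle i\beta,\eta\rangle_H\,\omega-\int_M\gamma_1\wedge\gamma_2,\qquad \langle\beta,\eta\rangle_H=\beta_1H\bar\eta_1+\bar\beta_2H\eta_2 .$$ The gauge group $\mathcal G$ of smooth maps $u:M\to U(1)$ acts on $\mathcal C$ by $u\cdot(A,\Psi,\Phi)=(A+u^{-1}du,\,u^{-1}\Psi,\,\Phi)$; its Lie algebra is $\Omega^0(M,i\mathbb R)$. For $\zeta\in\Omega^0(M,i\mathbb R)$ and $p=(A,\Psi,\Phi)\in\mathcal C$ put $$X_\zeta(p)=(d\zeta,-\zeta\Psi,0),\qquad \mu(p)=F_A-\tfrac i2\bigl(|\psi_1|_H^2+|\psi_2|_H^2\bigr)\,\omega,\qquad H_\zeta(p)=\int_M\zeta\,\mu(p).$$ **Proposition.** The equation $$F_A=\tfrac i2\bigl(|\psi_1|_H^2+|\psi_2|_H^2\bigr)\,\omega \tag{$*$}$$ is the zero level $\mu=0$ of a moment map for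 the action of the gauge group with respect to $\Omega$. Precisely: 1. For all $\zeta$ and $p$, $X_\zeta(p)$ is the velocity at $t=0$, pointwise on $M$, of the curve $t\mapsto e^{t\zeta}\cdot p$. 2. $X_\zeta$ is Hamiltonian with Hamiltonian $H_\zeta$: for all $\zeta$, $p$ and $X\in T_p\mathcal C$ the directional derivative of $H_\zeta$ exists, and $$dH_\zeta(X)=\frac{d}{dt}\Big|_{t=0}H_\zeta(p+tX)=\Omega(X_\zeta(p),X).$$ 3. $H_\zeta$ is real valued, and $\zeta\mapsto H_\zeta(p)$ is real linear for every $p$. 4. $\mu$ takes values in $\Omega^2(M,i\mathbb R)$ (smooth, purely imaginary valued $2$-forms), and $\mu(u\cdot p)=\mu(p)$ for all $u\in\mathcal G$ and $p\in\mathcal C$. 5. For every $p\in\mathcal C$: $p$ satisfies $(*)$ if and only if $\mu(p)=0$, and if and only if $H_\zeta(p)=0$ for all $\zeta\in\Omega^0(M,i\mathbb R)$, that is, if and only if $\mu(p)$ vanishes as an element of the dual of the Lie algebra. -/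

import Mathlib

set_option linter.unusedSectionVars false

open Bundle ContDiff Manifold

noncomputable section

namespace GaugeSurface

/-! ### Underlying real structures -/

/-- A Riemann surface is a smooth real surface. -/
instance isManifold_real {M : Type*} [TopologicalSpace M] [ChartedSpace ℂ M]
    [IsManifold 𝓘(ℂ, ℂ) ω M] : IsManifold 𝓘(ℝ, ℂ) ∞ M := by
  refine isManifold_of_contDiffOn _ _ _ fun e e' he he' => ?_
  have h1 := HasGroupoid.compatible (G := contDiffGroupoid ω 𝓘(ℂ, ℂ)) he he'
  rw [contDiffGroupoid, mem_groupoid_of_pregroupoid] at h1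
  exact (ContDiffOn.restrict_scalars ℝ h1.1).of_le le_top

/-- A complex vector bundle is a real vector bundle. -/
instance vectorBundle_real {M : Type*} {L : M → Type*} [TopologicalSpace M]
    [TopologicalSpace (TotalSpace ℂ L)] [∀ x, NormedAddCommGroup (L x)]
    [∀ x, InnerProductSpace ℂ (L x)] [FiberBundle ℂ L] [VectorBundle ℂ ℂ L] :
    VectorBundle ℝ ℂ L := by
  have hlin : ∀ (e : Trivialization ℂ (π ℂ L)) [MemTrivializationAtlas e], e.IsLinear ℝ :=
    fun e _ => ⟨fun b hb => ⟨(e.linear ℂ hb).1, fun c v => by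
      simpa using (e.linear ℂ hb).2 (c : ℂ) v⟩⟩
  refine ⟨fun e _ => hlin e, fun e e' _ _ => ?_⟩
  have h := continuousOn_coordChange ℂ e e'
  have := (ContinuousLinearMap.restrictScalarsL ℂ ℂ ℂ ℝ ℝ).continuous.comp_continuousOn h
  refine this.congr fun b hb => ?_
  have := hlin e
  have := hlin e'
  ext
  simp [Trivialization.coordChangeL_apply e e' hb]

/-! ### Differential forms on the surface -/

section Forms

variable (M : Type*) [TopologicalSpace M] [ChartedSpace ℂ M] [IsManifold 𝓘(ℝ, ℂ) ∞ M]

/-- `Ω¹(M, ℂ)`: smooth complex valued one-forms. -/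
abbrev OneForm : Type _ :=
  ContMDiffSection 𝓘(ℝ, ℂ) (ℂ →L[ℝ] ℂ) ∞ (fun x : M => TangentSpace 𝓘(ℝ, ℂ) x →L[ℝ] ℂ)

instance : AddCommGroup (OneForm M) := inferInstance

instance : Module ℝ (OneForm M) := inferInstance

/-- `Ω¹(M, iℝ)`: smooth one-forms with purely imaginary values. -/
def ImOneForm : Submodule ℝ (OneForm M) where
  carrier := {α | ∀ x v, (α x v).re = 0}
  add_mem' {a b} ha hb x v := by
    have h1 := ha x v
    have h2 := hb x v
    simp [h1, h2]
  zero_mem' x v := by simp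
  smul_mem' c a ha x v := by
    have h1 := ha x v
    simp [h1]

instance : AddCommGroup (ImOneForm M) := inferInstance

instance : Module ℝ (ImOneForm M) := inferInstance

/-- (Not necessarily smooth) complex valued two-forms. -/
abbrev TwoForm : Type _ := ∀ x : M, TangentSpace 𝓘(ℝ, ℂ) x [⋀^Fin 2]→L[ℝ] ℂ

/-- `Ω⁰(M, iℝ)`, the Lie algebra of the gauge group. -/
def ImFun : Submodule ℝ C^∞⟮𝓘(ℝ, ℂ), M; 𝓘(ℝ, ℂ), ℂ⟯ where
  carrier := {ζ | ∀ x, (ζ x).re = 0}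
  add_mem' {a b} ha hb x := by
    have h1 := ha x
    have h2 := hb x
    simp [h1, h2]
  zero_mem' x := by simp
  smul_mem' c a ha x := by
    have h1 := ha x
    simp [h1]

variable {M}

/-- `a ∧ b` for two linear functionals: `(v, w) ↦ a v * b w - a w * b v`. -/
def wedgeAt {V : Type*} [AddCommGroup V] [Module ℝ V] [TopologicalSpace V]
    (a b : V →L[ℝ] ℂ) : V [⋀^Fin 2]→L[ℝ] ℂ where
  toFun v := a (v 0) * b (v 1) - a (v 1) * b (v 0)
  map_update_add' v i x y := by
    fin_cases i <;> simp [Function.update] <;> ring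
  map_update_smul' v i c x := by
    fin_cases i <;> simp [Function.update] <;> ring
  map_eq_zero_of_eq' v i j h hij := by
    fin_cases i <;> fin_cases j <;> simp_all
  cont := by fun_prop

/-- The wedge product of two one-forms. -/
def wedge (α β : OneForm M) : TwoForm M := fun x => wedgeAt (α x) (β x)

/-- The coordinate expression on `ℂ` of a one-form, in the preferred chart at `p`
(meaningful on the target of the chart). -/
def chartForm (p : M) (α : ∀ x : M, TangentSpace 𝓘(ℝ, ℂ) x →L[ℝ] ℂ) (z : ℂ) : ℂ →L[ℝ] ℂ :=
  (α ((chartAt ℂ p).symm z)).comp (mfderiv 𝓘(ℝ, ℂ) 𝓘(ℝ, ℂ) (chartAt ℂ p).symm z)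

/-- The exterior derivative of a one-form, computed at each point `x` in the preferred chart
at `x` with the exterior derivative of `ℂ = ℝ²`. -/
def extD (α : ∀ x : M, TangentSpace 𝓘(ℝ, ℂ) x →L[ℝ] ℂ) : TwoForm M := fun x =>
  (extDeriv (fun z : ℂ => ContinuousAlternatingMap.ofSubsingleton ℝ ℂ ℂ (0 : Fin 1)
      (chartForm x α z)) (chartAt ℂ x x)).compContinuousLinearMap
    (mfderiv 𝓘(ℝ, ℂ) 𝓘(ℝ, ℂ) (chartAt ℂ x) x)

/-- The coefficient `f` in the expression `η = f dx ∧ dy` of a two-form in the preferred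
holomorphic coordinate `z = x + iy` at `p` (meaningful on the target of the chart). -/
def density (p : M) (η : TwoForm M) (z : ℂ) : ℂ :=
  η ((chartAt ℂ p).symm z)
    ![mfderiv 𝓘(ℝ, ℂ) 𝓘(ℝ, ℂ) (chartAt ℂ p).symm z (1 : ℂ),
      mfderiv 𝓘(ℝ, ℂ) 𝓘(ℝ, ℂ) (chartAt ℂ p).symm z Complex.I]

/-- Smoothness of a two-form. -/
def TwoForm.IsSmooth (η : TwoForm M) : Prop :=
  ∀ p : M, ContDiffOn ℝ ∞ (density p η) (chartAt ℂ p).target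

/-- `w` is a positive real smooth two-form: in every preferred holomorphic coordinate
`w = f dx ∧ dy = (f / 2) i dz ∧ dz̄` with `f > 0` smooth. These are exactly the forms
`i e^{2σ} h² dz ∧ dz̄`, for `h² dz ⊗ dz̄` a conformal metric and `σ` a smooth real function. -/
structure IsAreaForm (w : TwoForm M) : Prop where
  smooth : TwoForm.IsSmooth w
  pos : ∀ p : M, ∀ z ∈ (chartAt ℂ p).target, ∃ r : ℝ, 0 < r ∧ density p w z = (r : ℂ)

/-- A smooth partition of unity subordinate to the domains of the preferred charts. -/
def chartPartition (M : Type*) [TopologicalSpace M] [ChartedSpace ℂ M]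
    [IsManifold 𝓘(ℝ, ℂ) ∞ M] [T2Space M] [SigmaCompactSpace M] :
    SmoothPartitionOfUnity M 𝓘(ℝ, ℂ) M :=
  (SmoothPartitionOfUnity.exists_isSubordinate_chartAt_source 𝓘(ℝ, ℂ) M).choose

/-- The integral over the surface (with its complex orientation) of a two-form:
the sum of the integrals, in the charts, of the pieces cut out by a partition of unity. -/
def integral [T2Space M] [SigmaCompactSpace M] (η : TwoForm M) : ℂ :=
  ∑ᶠ p : M, ∫ z in (chartAt ℂ p).target,
    ((chartPartition M p ((chartAt ℂ p).symm z) : ℝ) : ℂ) * density p η z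

/-- Smoothness of a one-form at a point, read in the tangent trivialization. -/
theorem contMDiffAt_oneForm_iff {α : ∀ x : M, TangentSpace 𝓘(ℝ, ℂ) x →L[ℝ] ℂ} {x₀ : M} :
    ContMDiffAt 𝓘(ℝ, ℂ) (𝓘(ℝ, ℂ).prod 𝓘(ℝ, ℂ →L[ℝ] ℂ)) ∞
      (fun x => (TotalSpace.mk' (ℂ →L[ℝ] ℂ) x (α x) :
        TotalSpace (ℂ →L[ℝ] ℂ) (fun x : M => TangentSpace 𝓘(ℝ, ℂ) x →L[ℝ] ℂ))) x₀ ↔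
    ContMDiffAt 𝓘(ℝ, ℂ) 𝓘(ℝ, ℂ →L[ℝ] ℂ) ∞ (fun x => (α x).comp
      ((trivializationAt ℂ (TangentSpace 𝓘(ℝ, ℂ)) x₀).symmL ℝ x)) x₀ := by
  rw [contMDiffAt_hom_bundle]
  have key : ∀ x : M, ContinuousLinearMap.inCoordinates ℂ (TangentSpace 𝓘(ℝ, ℂ)) ℂ
      (Bundle.Trivial M ℂ) x₀ x x₀ x (α x) =
      (α x).comp ((trivializationAt ℂ (TangentSpace 𝓘(ℝ, ℂ)) x₀).symmL ℝ x) := by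
    intro x
    ext v
    simp [ContinuousLinearMap.inCoordinates]
  exact ⟨fun h => h.2.congr_of_eventuallyEq (.of_forall fun x => (key x).symm),
    fun h => ⟨contMDiffAt_id, h.congr_of_eventuallyEq (.of_forall key)⟩⟩

/-- The product of a smooth complex function and a smooth one-form is smooth. -/
theorem contMDiff_smul_oneForm {f : M → ℂ} {α : ∀ x : M, TangentSpace 𝓘(ℝ, ℂ) x →L[ℝ] ℂ}
    (hf : ContMDiff 𝓘(ℝ, ℂ) 𝓘(ℝ, ℂ) ∞ f)
    (hα : ContMDiff 𝓘(ℝ, ℂ) (𝓘(ℝ, ℂ).prod 𝓘(ℝ, ℂ →L[ℝ] ℂ)) ∞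
      (fun x => (TotalSpace.mk' (ℂ →L[ℝ] ℂ) x (α x) :
        TotalSpace (ℂ →L[ℝ] ℂ) (fun x : M => TangentSpace 𝓘(ℝ, ℂ) x →L[ℝ] ℂ)))) :
    ContMDiff 𝓘(ℝ, ℂ) (𝓘(ℝ, ℂ).prod 𝓘(ℝ, ℂ →L[ℝ] ℂ)) ∞
      (fun x => (TotalSpace.mk' (ℂ →L[ℝ] ℂ) x (f x • α x) :
        TotalSpace (ℂ →L[ℝ] ℂ) (fun x : M => TangentSpace 𝓘(ℝ, ℂ) x →L[ℝ] ℂ))) := by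
  intro x₀
  have h := contMDiffAt_oneForm_iff.1 (hα x₀)
  refine contMDiffAt_oneForm_iff.2 ?_
  exact (contDiff_smul (𝕜 := ℝ) (F := ℂ →L[ℝ] ℂ)).contMDiff.contMDiffAt.comp x₀
    ((hf x₀).prodMk_space h)

/-- The differential of a smooth function is a smooth one-form. -/
theorem contMDiff_mvfderiv {f : M → ℂ} (hf : ContMDiff 𝓘(ℝ, ℂ) 𝓘(ℝ, ℂ) ∞ f) :
    ContMDiff 𝓘(ℝ, ℂ) (𝓘(ℝ, ℂ).prod 𝓘(ℝ, ℂ →L[ℝ] ℂ)) ∞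
      (fun x => (TotalSpace.mk' (ℂ →L[ℝ] ℂ) x (mvfderiv 𝓘(ℝ, ℂ) f x) :
        TotalSpace (ℂ →L[ℝ] ℂ) (fun x : M => TangentSpace 𝓘(ℝ, ℂ) x →L[ℝ] ℂ))) := by
  intro x₀
  have := (hf x₀).mfderiv_const (m := ∞) le_rfl
  refine contMDiffAt_oneForm_iff.2 (this.congr_of_eventuallyEq (.of_forall fun x => ?_))
  ext v
  simp [inTangentCoordinates, ContinuousLinearMap.inCoordinates, mvfderiv]
  try rfl

/-- `dζ` as an element of `Ω¹(M, iℝ)`. -/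
def dIm (ζ : ImFun M) : ImOneForm M :=
  ⟨⟨fun x => mvfderiv 𝓘(ℝ, ℂ) (ζ : C^∞⟮𝓘(ℝ, ℂ), M; 𝓘(ℝ, ℂ), ℂ⟯) x,
    contMDiff_mvfderiv ζ.1.contMDiff⟩, by
    intro x v
    have hd : MDifferentiableAt 𝓘(ℝ, ℂ) 𝓘(ℝ, ℂ) ζ.1 x :=
      ζ.1.contMDiff.mdifferentiableAt (by simp)
    have h1 := (Complex.reCLM.hasMFDerivAt (x := ζ.1 x)).comp x hd.hasMFDerivAt
    have h2 : (⇑Complex.reCLM ∘ ⇑ζ.1) = fun _ => (0 : ℝ) := by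
      funext y
      exact ζ.2 y
    rw [h2] at h1
    have h3 := congrArg (fun T => T v) (hasMFDerivAt_unique h1 (hasMFDerivAt_const (0 : ℝ) x))
    exact h3⟩

variable (M) in
/-- The gauge group `Maps(M, U(1))` of smooth circle valued functions. -/
abbrev GaugeGroup : Type _ := C^∞⟮𝓘(ℝ, ℂ), M; 𝓡 1, Circle⟯

theorem contMDiff_gauge_coe (u : GaugeGroup M) :
    ContMDiff 𝓘(ℝ, ℂ) 𝓘(ℝ, ℂ) ∞ (fun x => (u x : ℂ)) := by
  have : Fact (Module.finrank ℝ ℂ = 1 + 1) := ⟨Complex.finrank_real_complex⟩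
  exact (contMDiff_coe_sphere (E := ℂ) (n := 1) (m := ∞)).comp u.contMDiff

/-- `u⁻¹ du` as an element of `Ω¹(M, iℝ)`. -/
def logD (u : GaugeGroup M) : ImOneForm M :=
  ⟨⟨fun x => (u x : ℂ)⁻¹ • mvfderiv 𝓘(ℝ, ℂ) (fun y => (u y : ℂ)) x, by
    have hu := contMDiff_gauge_coe u
    refine contMDiff_smul_oneForm ?_ (contMDiff_mvfderiv hu)
    simp only [← Circle.coe_inv, Circle.coe_inv_eq_conj]
    exact Complex.conjCLE.contDiff.contMDiff.comp hu⟩, by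
    intro x v
    have hd : MDifferentiableAt 𝓘(ℝ, ℂ) 𝓘(ℝ, ℂ) (fun y => (u y : ℂ)) x :=
      (contMDiff_gauge_coe u).mdifferentiableAt (by simp)
    have h1 := ((hasStrictFDerivAt_norm_sq (u x : ℂ)).hasFDerivAt.hasMFDerivAt).comp x
      hd.hasMFDerivAt
    have h2 : ((fun z : ℂ => ‖z‖ ^ 2) ∘ fun y => (u y : ℂ)) = fun _ => (1 : ℝ) := by
      funext y
      simp [Circle.norm_coe]
    rw [h2] at h1
    have h3 := congrArg (fun T => T v) (hasMFDerivAt_unique h1 (hasMFDerivAt_const (1 : ℝ) x))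
    have h4 : 2 * inner ℝ (u x : ℂ) (mvfderiv 𝓘(ℝ, ℂ) (fun y => (u y : ℂ)) x v) = 0 := by
      have h6 : (2 • innerSL ℝ (u x : ℂ)) (mvfderiv 𝓘(ℝ, ℂ) (fun y => (u y : ℂ)) x v) = 0 := h3
      simpa [two_smul, two_mul] using h6
    have h5 : inner ℝ (u x : ℂ) (mvfderiv 𝓘(ℝ, ℂ) (fun y => (u y : ℂ)) x v) = 0 := by
      linarith
    rw [Complex.inner] at h5
    change ((u x : ℂ)⁻¹ * mvfderiv 𝓘(ℝ, ℂ) (fun y => (u y : ℂ)) x v).re = 0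
    rw [← Circle.coe_inv, Circle.coe_inv_eq_conj]
    simpa [mul_comm] using h5⟩

/-- The gauge transformation `exp ζ`. -/
def expGauge (ζ : ImFun M) : GaugeGroup M :=
  ⟨fun x => Circle.exp ((ζ : C^∞⟮𝓘(ℝ, ℂ), M; 𝓘(ℝ, ℂ), ℂ⟯) x).im,
    contMDiff_circleExp.comp (Complex.imCLM.contDiff.contMDiff.comp ζ.1.contMDiff)⟩

end Forms

/-! ### Sections and unitary connections of a Hermitian line bundle -/

section LineBundle

variable {M : Type*} [TopologicalSpace M] [ChartedSpace ℂ M] [IsManifold 𝓘(ℝ, ℂ) ∞ M]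
  (L : M → Type*) [TopologicalSpace (TotalSpace ℂ L)] [∀ x, NormedAddCommGroup (L x)]
  [∀ x, InnerProductSpace ℂ (L x)] [FiberBundle ℂ L] [VectorBundle ℂ ℂ L]
  [ContMDiffVectorBundle ∞ ℂ L 𝓘(ℝ, ℂ)]

/-- `Γ(M, L)`: smooth sections. -/
abbrev Sec : Type _ := ContMDiffSection 𝓘(ℝ, ℂ) ℂ ∞ L

instance : AddCommGroup (Sec L) := inferInstance

instance : Module ℝ (Sec L) := inferInstance

/-- The Hermitian inner products on the fibres depend smoothly on the base point. -/
class IsSmoothHermitian : Prop where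
  smooth_inner : ∀ (U : Set M), IsOpen U → ∀ σ τ : (∀ x, L x),
    ContMDiffOn 𝓘(ℝ, ℂ) (𝓘(ℝ, ℂ).prod 𝓘(ℝ, ℂ)) ∞ (fun x => TotalSpace.mk' ℂ x (σ x)) U →
    ContMDiffOn 𝓘(ℝ, ℂ) (𝓘(ℝ, ℂ).prod 𝓘(ℝ, ℂ)) ∞ (fun x => TotalSpace.mk' ℂ x (τ x)) U →
    ContMDiffOn 𝓘(ℝ, ℂ) 𝓘(ℝ, ℂ) ∞ (fun x => inner ℂ (σ x) (τ x)) U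

/-- Differentiability at a point of a section of `L`. -/
def SecDiffAt (σ : ∀ x, L x) (x : M) : Prop :=
  MDifferentiableAt 𝓘(ℝ, ℂ) (𝓘(ℝ, ℂ).prod 𝓘(ℝ, ℂ)) (fun y => TotalSpace.mk' ℂ y (σ y)) x

/-- Smooth unitary connections of the Hermitian line bundle `L`, as covariant derivatives:
complex linear, smooth, compatible with the Hermitian metric. As a covariant derivative here acts on
all set-theoretic sections and means nothing where the section is not differentiable, it is
normalized to be `0` there. -/
@[ext]
structure UnitaryConnection extends CovariantDerivative 𝓘(ℝ, ℂ) ℂ L where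
  smooth : ∀ U : Set M, IsOpen U → ContMDiffCovariantDerivativeOn ℂ ∞ toFun U
  map_I_smul : ∀ (σ : ∀ x, L x) (x : M), SecDiffAt L σ x → ∀ v : TangentSpace 𝓘(ℝ, ℂ) x,
    toFun (fun y => Complex.I • σ y) x v = Complex.I • toFun σ x v
  metric : ∀ (σ τ : ∀ x, L x) (x : M), SecDiffAt L σ x → SecDiffAt L τ x →
    ∀ v : TangentSpace 𝓘(ℝ, ℂ) x,
      mvfderiv 𝓘(ℝ, ℂ) (fun y => inner ℂ (σ y) (τ y)) x v =
        inner ℂ (toFun σ x v) (τ x) + inner ℂ (σ x) (toFun τ x v)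
  eq_zero_of_not_diff : ∀ (σ : ∀ x, L x) (x : M), ¬ SecDiffAt L σ x → toFun σ x = 0


variable {L}

/-- Product of a smooth complex function and a smooth section. -/
def smulSec (f : C^∞⟮𝓘(ℝ, ℂ), M; 𝓘(ℝ, ℂ), ℂ⟯) (s : Sec L) : Sec L :=
  ⟨fun x => f x • s x, by
    intro x₀
    have hs := s.contMDiff x₀
    rw [contMDiffAt_section] at hs ⊢
    refine ((contDiff_smul (𝕜 := ℝ) (F := ℂ)).contMDiff.contMDiffAt.comp x₀
      ((f.contMDiff x₀).prodMk_space hs)).congr_of_eventuallyEq ?_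
    filter_upwards [(trivializationAt ℂ L x₀).open_baseSet.mem_nhds
      (mem_baseSet_trivializationAt ℂ L x₀)] with x hx
    exact ((trivializationAt ℂ L x₀).linear ℂ hx).2 _ _⟩

theorem contMDiffOn_smulRight {α : OneForm M} {σ : ∀ x, L x} {U : Set M}
    (hU : IsOpen U)
    (hσ : ContMDiffOn 𝓘(ℝ, ℂ) (𝓘(ℝ, ℂ).prod 𝓘(ℝ, ℂ)) ∞ (fun x => TotalSpace.mk' ℂ x (σ x)) U) :
    ContMDiffOn 𝓘(ℝ, ℂ) (𝓘(ℝ, ℂ).prod 𝓘(ℝ, ℂ →L[ℝ] ℂ)) ∞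
      (fun x => (TotalSpace.mk' (ℂ →L[ℝ] ℂ) x ((α x).smulRight (σ x)) :
        TotalSpace (ℂ →L[ℝ] ℂ) (fun x : M => TangentSpace 𝓘(ℝ, ℂ) x →L[ℝ] L x))) U := by
  intro x₀ hx₀
  have h1 := contMDiffAt_oneForm_iff.1 (α.contMDiff x₀)
  have h2 := (hσ x₀ hx₀).contMDiffAt (hU.mem_nhds hx₀)
  rw [contMDiffAt_section] at h2
  refine ContMDiffAt.contMDiffWithinAt ?_
  rw [contMDiffAt_hom_bundle]
  refine ⟨contMDiffAt_id, ?_⟩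
  have h3 : ContDiff ℝ ∞ (fun q : (ℂ →L[ℝ] ℂ) × ℂ => q.1.smulRight q.2) := by
    have h4 : (fun q : (ℂ →L[ℝ] ℂ) × ℂ => q.1.smulRight q.2) =
        fun q => ((ContinuousLinearMap.mul ℝ ℂ).flip q.2).comp q.1 := by
      funext q
      ext v
      simp [mul_comm]
    rw [h4]
    exact ((ContinuousLinearMap.mul ℝ ℂ).flip.contDiff.comp contDiff_snd).clm_comp contDiff_fst
  refine (h3.contMDiff.contMDiffAt.comp x₀ (h1.prodMk_space h2)).congr_of_eventuallyEq ?_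
  filter_upwards [(trivializationAt ℂ L x₀).open_baseSet.mem_nhds
    (mem_baseSet_trivializationAt ℂ L x₀)] with x hx
  ext
  simp only [ContinuousLinearMap.inCoordinates, ContinuousLinearMap.comp_apply,
    ContinuousLinearMap.smulRight_apply, Trivialization.continuousLinearMapAt_apply,
    Trivialization.coe_linearMapAt_of_mem _ hx]
  exact ((trivializationAt ℂ L x₀).linear ℂ hx).2 _ _

theorem SecDiffAt.add {σ τ : ∀ x, L x} {x : M} (hσ : SecDiffAt L σ x) (hτ : SecDiffAt L τ x) :
    SecDiffAt L (σ + τ) x :=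
  mdifferentiableAt_add_section hσ hτ

theorem SecDiffAt.smul {f : M → ℝ} {σ : ∀ x, L x} {x : M}
    (hf : MDifferentiableAt 𝓘(ℝ, ℂ) 𝓘(ℝ, ℝ) f x) (hσ : SecDiffAt L σ x) :
    SecDiffAt L (f • σ) x :=
  hf.smul_section hσ

theorem SecDiffAt.const_smul (c : ℂ) {σ : ∀ x, L x} {x : M} (hσ : SecDiffAt L σ x) :
    SecDiffAt L (fun y => c • σ y) x := by
  unfold SecDiffAt at *
  rw [mdifferentiableAt_section] at *
  refine (((ContinuousLinearMap.mul ℝ ℂ c).differentiableAt.mdifferentiableAt).comp x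
    hσ).congr_of_eventuallyEq ?_
  filter_upwards [(trivializationAt ℂ L x).open_baseSet.mem_nhds
    (mem_baseSet_trivializationAt ℂ L x)] with y hy
  exact ((trivializationAt ℂ L x).linear ℂ hy).2 _ _

open Classical in
/-- The connection `A + α`. -/
def UnitaryConnection.addForm (A : UnitaryConnection L) (α : ImOneForm M) :
    UnitaryConnection L where
  toFun σ x := if SecDiffAt L σ x then A.toFun σ x + ((α : OneForm M) x).smulRight (σ x) else 0
  isCovariantDerivativeOnUniv :=
    { add := fun {σ τ x} hσ hτ _ => by
        have h1 : SecDiffAt L σ x := hσ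
        have h2 : SecDiffAt L τ x := hτ
        have h3 := A.isCovariantDerivativeOnUniv.add hσ hτ
        simp only [h1, h2, h1.add h2, if_true, h3]
        ext v
        simp [smul_add]
        abel
      leibniz := fun {σ f x} hσ hf _ => by
        have h1 : SecDiffAt L σ x := hσ
        have h3 := A.isCovariantDerivativeOnUniv.leibniz hσ hf
        simp only [h1, h1.smul hf, if_true, h3]
        ext v
        simp [smul_add, smul_comm (f x)]
        abel }
  smooth U hU :=
    { contMDiff := fun {σ} hσ => by
        have hd : ∀ x ∈ U, SecDiffAt L σ x := fun x hx =>
          ((hσ x hx).contMDiffAt (hU.mem_nhds hx)).mdifferentiableAt (by simp)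
        have h1 := (A.smooth U hU).contMDiff hσ
        have h2 := contMDiffOn_smulRight (α := (α : OneForm M)) hU (hσ.of_le (by simp))
        have h3 := ContMDiffOn.add_section h1 h2
        refine h3.congr fun x hx => ?_
        simp [hd x hx] }
  map_I_smul σ x hσ v := by
    have h3 := A.map_I_smul σ x hσ v
    simp only [hσ, hσ.const_smul Complex.I, if_true, add_apply, h3]
    simp [smul_comm _ Complex.I]
  metric σ τ x hσ hτ v := by
    have h3 := A.metric σ τ x hσ hτ v
    have h4 : (starRingEnd ℂ) ((α : OneForm M) x v) + (α : OneForm M) x v = 0 := by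
      rw [add_comm, Complex.add_conj]
      simp [α.2 x v]
    have key : ∀ ρ : (∀ x, L x), (A.toFun ρ x + ((α : OneForm M) x).smulRight (ρ x)) v =
        A.toFun ρ x v + (α : OneForm M) x v • ρ x := fun ρ => rfl
    simp only [hσ, hτ, if_true, h3, key, inner_add_left, inner_add_right, inner_smul_left,
      inner_smul_right]
    linear_combination (-inner ℂ (σ x) (τ x)) * h4
  eq_zero_of_not_diff σ x h := by simp [h]

/-- The frame of `L` near `x₀` given by the preferred trivialization at `x₀`. -/
def localFrame (x₀ : M) : ∀ x, L x := fun x => (trivializationAt ℂ L x₀).symm x 1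

/-- The connection form `θ` of `A` in the frame `e` given by the preferred trivialization
at `x₀`: `∇ e = θ e` (meaningful on the domain of the trivialization). -/
def UnitaryConnection.localForm (A : UnitaryConnection L) (x₀ : M) :
    ∀ x : M, TangentSpace 𝓘(ℝ, ℂ) x →L[ℝ] ℂ := fun x =>
  ((trivializationAt ℂ L x₀).continuousLinearMapAt ℝ x).comp (A.toFun (localFrame x₀) x)

/-- The curvature form `F_A`: near `x₀` it is `dθ`, with `θ` the local connection form. -/
def UnitaryConnection.curvature (A : UnitaryConnection L) : TwoForm M :=
  fun x₀ => extD (A.localForm x₀) x₀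

end LineBundle

/-! ### The configuration space, the gauge action, the symplectic form -/

section Moment

variable {M : Type*} [TopologicalSpace M] [ChartedSpace ℂ M] [IsManifold 𝓘(ℝ, ℂ) ∞ M]
  (L : M → Type*) [TopologicalSpace (TotalSpace ℂ L)] [∀ x, NormedAddCommGroup (L x)]
  [∀ x, InnerProductSpace ℂ (L x)] [FiberBundle ℂ L] [VectorBundle ℂ ℂ L]
  [ContMDiffVectorBundle ∞ ℂ L 𝓘(ℝ, ℂ)]

/-- The configuration space `𝒞 = 𝒜 × Γ(M, L ⊕ L) × Ω¹(M, iℝ)`. The section `Ψ` of `L ⊕ L` has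
components `Ψ.1 = ψ₁` and `Ψ.2 = ψ̄₂`. -/
@[ext]
structure Config where
  A : UnitaryConnection L
  Ψ : Sec L × Sec L
  Φ : ImOneForm M

/-- The tangent space `Ω¹(M, iℝ) × Γ(M, L ⊕ L) × Ω¹(M, iℝ)` of the affine space `𝒞` at any of its
points; a tangent vector is `(α, β, γ)` with `β.1 = β₁` and `β.2 = β̄₂`. -/
abbrev TangentVec : Type _ := ImOneForm M × (Sec L × Sec L) × ImOneForm M

instance : AddCommGroup (TangentVec L) := inferInstance

instance : Module ℝ (TangentVec L) := inferInstance

variable {L}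

/-- The affine structure of `𝒞`: the point `p + X`. -/
def Config.translate (p : Config L) (X : TangentVec L) : Config L where
  A := p.A.addForm X.1
  Ψ := p.Ψ + X.2.1
  Φ := p.Φ + X.2.2

/-- A circle valued function as a complex function. -/
def gaugeFun (u : GaugeGroup M) : C^∞⟮𝓘(ℝ, ℂ), M; 𝓘(ℝ, ℂ), ℂ⟯ :=
  ⟨fun x => (u x : ℂ), contMDiff_gauge_coe u⟩

/-- The gauge action `u · (A, Ψ, Φ) = (A + u⁻¹ du, u⁻¹ Ψ, Φ)`. -/
def gaugeAct (u : GaugeGroup M) (p : Config L) : Config L where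
  A := p.A.addForm (logD u)
  Ψ := (smulSec (gaugeFun u⁻¹) p.Ψ.1, smulSec (gaugeFun u⁻¹) p.Ψ.2)
  Φ := p.Φ

/-- The vector field `X_ζ (A, Ψ, Φ) = (dζ, -ζ Ψ, 0)`. -/
def infGauge (ζ : ImFun M) (p : Config L) : TangentVec L :=
  (dIm ζ, (-smulSec (ζ : C^∞⟮𝓘(ℝ, ℂ), M; 𝓘(ℝ, ℂ), ℂ⟯) p.Ψ.1,
    -smulSec (ζ : C^∞⟮𝓘(ℝ, ℂ), M; 𝓘(ℝ, ℂ), ℂ⟯) p.Ψ.2), 0)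

/-- The curve `c` in `𝒞` has velocity `X` at time `0` (pointwise on `M`). -/
structure HasVelocity (c : ℝ → Config L) (X : TangentVec L) : Prop where
  connection : ∀ (σ : ∀ x, L x) (x : M), SecDiffAt L σ x → ∀ v : TangentSpace 𝓘(ℝ, ℂ) x,
    HasDerivAt (fun t => (c t).A.toFun σ x v) ((X.1 : OneForm M) x v • σ x) 0
  spinor₁ : ∀ x, HasDerivAt (fun t => (c t).Ψ.1 x) (X.2.1.1 x) 0
  spinor₂ : ∀ x, HasDerivAt (fun t => (c t).Ψ.2 x) (X.2.1.2 x) 0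
  higgs : ∀ (x : M) (v : TangentSpace 𝓘(ℝ, ℂ) x),
    HasDerivAt (fun t => ((c t).Φ : OneForm M) x v) ((X.2.2 : OneForm M) x v) 0

/-- The pairing `⟨β, η⟩_H = β₁ H η̄₁ + β̄₂ H η₂` of sections of `L ⊕ L`, complex linear in `β`
(Mathlib's `inner` is linear in its second argument). -/
def hermPair (β η : Sec L × Sec L) (x : M) : ℂ :=
  inner ℂ (η.1 x) (β.1 x) + inner ℂ (η.2 x) (β.2 x)

/-- `I β = (i β₁, i β̄₂)`. -/
def mulI (β : Sec L × Sec L) : Sec L × Sec L :=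
  (smulSec ⟨fun _ => Complex.I, contMDiff_const⟩ β.1,
    smulSec ⟨fun _ => Complex.I, contMDiff_const⟩ β.2)

/-- The symplectic form
`Ω(X, Y) = - ∫ α₁ ∧ α₂ + ∫ Re ⟨I β, η⟩_H ω - ∫ γ₁ ∧ γ₂`
for `X = (α₁, β, γ₁)` and `Y = (α₂, η, γ₂)`, where `w` is the area form `ω`. -/
def sympForm [T2Space M] [SigmaCompactSpace M] (w : TwoForm M) (X Y : TangentVec L) : ℂ :=
  - integral (wedge (X.1 : OneForm M) Y.1)
  + integral (fun x => ((hermPair (mulI X.2.1) Y.2.1 x).re : ℂ) • w x)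
  - integral (wedge (X.2.2 : OneForm M) Y.2.2)

/-- `|ψ₁|_H² + |ψ₂|_H²`. -/
def spinorNormSq (p : Config L) (x : M) : ℝ := ‖p.Ψ.1 x‖ ^ 2 + ‖p.Ψ.2 x‖ ^ 2

/-- The curvature equation `F_A = i (|ψ₁|_H² + |ψ₂|_H²) / 2 ω`. -/
def CurvatureEq (w : TwoForm M) (p : Config L) : Prop :=
  ∀ x, p.A.curvature x = (Complex.I * (spinorNormSq p x / 2 : ℝ)) • w x

/-- The moment map `μ(A, Ψ, Φ) = F_A - i (|ψ₁|_H² + |ψ₂|_H²) / 2 ω`. -/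
def momentMap (w : TwoForm M) (p : Config L) : TwoForm M := fun x =>
  p.A.curvature x - (Complex.I * (spinorNormSq p x / 2 : ℝ)) • w x

/-- The Hamiltonian `H_ζ(p) = ∫ ζ (F_A - i (|ψ₁|_H² + |ψ₂|_H²) / 2 ω)`, that is, the pairing of
`ζ` with the moment map. -/
def hamiltonian [T2Space M] [SigmaCompactSpace M] (w : TwoForm M) (ζ : ImFun M)
    (p : Config L) : ℂ :=
  integral (fun x => (ζ : C^∞⟮𝓘(ℝ, ℂ), M; 𝓘(ℝ, ℂ), ℂ⟯) x • momentMap w p x)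

end Moment
end GaugeSurface
end

/-! The analytic heart is one integration by parts. The curvature is affine in the connection,
`F_{A+α} = F_A + dα` (`UnitaryConnection.curvature_addForm`), and the spinor term is quadratic, so
`t ↦ H_ζ(p + tX)` is exactly a quadratic polynomial and its derivative at `0` is the linear
coefficient `∫ ζ (dα - i Re⟨Ψ, β⟩ ω)`; no differentiation under the integral is involved. Stokes'
theorem for `ζα` turns `∫ ζ dα` into `-∫ dζ ∧ α`, the first term of `Ω(X_ζ, X)`. Since `ζ` is
imaginary, `i(-ζ) = Im ζ` and `-iζ = Im ζ`, so the spinor terms agree pointwise; the last term of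
`Ω` vanishes because `X_ζ` has no `Φ` component. This is `sympForm_infGauge`.

Two-forms are handled through `density`, one complex function per chart: a two-form on a surface is
determined by its value on the pair `(1, i)`, and a change of chart multiplies that value by a
Jacobian determinant. The exterior derivative becomes the scalar `curl`. Holomorphic transition maps
have nonnegative determinant, so the oriented change of variables holds (`integral_of_support`), and
Stokes' theorem reduces by a partition of unity to the vanishing integral of a derivative of a
compactly supported function.

A single local fact about connections is used three times: `g⁻¹ dg` is closed
(`extD_inv_smul_mvfderiv`). For the ratio `g` of two frames it makes the curvature independent of
the frame; for `g = u` circle valued it makes `μ` gauge invariant; for `g = |e|²` it gives `θ + θ̄ =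
g⁻¹ dg`, hence `F + F̄ = 0`, and the curvature is imaginary.

For the zero level, testing against `ζ = -μ/ω` makes `ζμ = |μ/ω|² ω` a nonnegative form; if its
integral vanishes, so does `μ`. -/

noncomputable section

namespace GaugeSurface

open Set Filter MeasureTheory
open scoped Topology

/-! ### Changes of chart and the densities of two-forms -/

section Transition

variable {M : Type*} [TopologicalSpace M] [ChartedSpace ℂ M] [IsManifold 𝓘(ℝ, ℂ) ∞ M]

/-- The transition map from the preferred chart at `p` to the preferred chart at `q`. -/
def transition (p q : M) : OpenPartialHomeomorph ℂ ℂ :=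
  (chartAt ℂ p).symm.trans (chartAt ℂ q)

theorem mem_transition_source {p q : M} {z : ℂ} :
    z ∈ (transition p q).source ↔
      z ∈ (chartAt ℂ p).target ∧ (chartAt ℂ p).symm z ∈ (chartAt ℂ q).source := by
  simp [transition]

theorem mem_transition_target {p q : M} {z : ℂ} :
    z ∈ (transition p q).target ↔
      z ∈ (chartAt ℂ q).target ∧ (chartAt ℂ q).symm z ∈ (chartAt ℂ p).source := by
  simp [transition]

theorem transition_apply (p q : M) (z : ℂ) :
    transition p q z = chartAt ℂ q ((chartAt ℂ p).symm z) := rfl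

theorem symm_transition {p q : M} {z : ℂ} (hz : z ∈ (transition p q).source) :
    (chartAt ℂ q).symm (transition p q z) = (chartAt ℂ p).symm z :=
  (chartAt ℂ q).left_inv (mem_transition_source.1 hz).2

theorem contDiffAt_transition {p q : M} {z : ℂ} (hz : z ∈ (transition p q).source) :
    ContDiffAt ℝ ∞ (transition p q) z := by
  have h1 := HasGroupoid.compatible (G := contDiffGroupoid ∞ 𝓘(ℝ, ℂ))
    (chart_mem_atlas ℂ p) (chart_mem_atlas ℂ q)
  rw [contDiffGroupoid, mem_groupoid_of_pregroupoid] at h1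
  have h2 : ContDiffOn ℝ ∞ (transition p q) (transition p q).source := by
    have h3 := h1.1
    simp only [contDiffPregroupoid, modelWithCornersSelf_coe, modelWithCornersSelf_coe_symm,
      Function.comp_id, Function.id_comp, preimage_id_eq, range_id, inter_univ, id] at h3
    exact h3
  exact h2.contDiffAt ((transition p q).open_source.mem_nhds hz)

theorem differentiableAt_transition {p q : M} {z : ℂ} (hz : z ∈ (transition p q).source) :
    DifferentiableAt ℝ (transition p q) z :=
  (contDiffAt_transition hz).differentiableAt (by simp)

theorem mdifferentiableAt_chart_symm {p : M} {z : ℂ} (hz : z ∈ (chartAt ℂ p).target) :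
    MDifferentiableAt 𝓘(ℝ, ℂ) 𝓘(ℝ, ℂ) (chartAt ℂ p).symm z :=
  (mdifferentiable_chart (I := 𝓘(ℝ, ℂ)) p).mdifferentiableAt_symm hz

/-- The chain rule for the inverse chart at `q` composed with the transition map. The two sides lie
in tangent spaces at points that are equal only propositionally, so they are compared in `ℂ`, to
which every tangent space unfolds. -/
theorem mfderiv_symm_transition {p q : M} {z : ℂ} (hz : z ∈ (transition p q).source) (v : ℂ) :
    (mfderiv 𝓘(ℝ, ℂ) 𝓘(ℝ, ℂ) (chartAt ℂ p).symm z v : ℂ) =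
      (mfderiv 𝓘(ℝ, ℂ) 𝓘(ℝ, ℂ) (chartAt ℂ q).symm (transition p q z)
        (fderiv ℝ (transition p q) z v) : ℂ) := by
  obtain ⟨h1, h2⟩ := mem_transition_source.1 hz
  have hw : transition p q z ∈ (chartAt ℂ q).target := (chartAt ℂ q).map_source h2
  have h3 : ((chartAt ℂ q).symm ∘ transition p q) =ᶠ[𝓝 z] (chartAt ℂ p).symm := by
    filter_upwards [(transition p q).open_source.mem_nhds hz] with y hy
    exact symm_transition hy
  have h4 : MDifferentiableAt 𝓘(ℝ, ℂ) 𝓘(ℝ, ℂ) (transition p q) z :=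
    (differentiableAt_transition hz).mdifferentiableAt
  have h5 := mfderiv_comp z (mdifferentiableAt_chart_symm hw) h4
  rw [h3.mfderiv_eq] at h5
  rw [mfderiv_eq_fderiv] at h5
  exact congrArg (fun T : ℂ →L[ℝ] ℂ => T v) h5

/-- The tangent space at `p` is identified with `ℂ` by the preferred chart at `p` itself, so this
chart has identity derivative at its centre. Pointwise identities of forms are therefore checked at
the centre of the chart. -/
theorem mfderiv_symm_self (p : M) (v : ℂ) :
    (mfderiv 𝓘(ℝ, ℂ) 𝓘(ℝ, ℂ) (chartAt ℂ p).symm (chartAt ℂ p p) v : ℂ) = v := by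
  have h := mfderivWithin_range_extChartAt_symm (I := 𝓘(ℝ, ℂ)) (x := p)
  simp only [mfld_simps] at h
  exact congrArg (fun T : ℂ →L[ℝ] ℂ => T v) h

theorem chartForm_congr {p q : M} {z : ℂ} (hz : z ∈ (transition p q).source)
    (α : ∀ x : M, TangentSpace 𝓘(ℝ, ℂ) x →L[ℝ] ℂ) :
    chartForm p α z = (chartForm q α (transition p q z)).comp (fderiv ℝ (transition p q) z) := by
  ext1 v
  have h := mfderiv_symm_transition hz v
  change α ((chartAt ℂ p).symm z) (mfderiv 𝓘(ℝ, ℂ) 𝓘(ℝ, ℂ) (chartAt ℂ p).symm z v) =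
    α ((chartAt ℂ q).symm (transition p q z)) (mfderiv 𝓘(ℝ, ℂ) 𝓘(ℝ, ℂ) (chartAt ℂ q).symm
      (transition p q z) (fderiv ℝ (transition p q) z v))
  -- Transport along an equality of base points: with both points as variables the equality can be
  -- substituted, and the dependent types no longer interfere. The same device recurs for two-forms.
  have key : ∀ (x y : M) (hxy : x = y) (v w : ℂ), v = w →
      (α x : ℂ →L[ℝ] ℂ) v = (α y : ℂ →L[ℝ] ℂ) w := by
    rintro x _ rfl v _ rfl
    rfl
  exact key _ _ (symm_transition hz).symm _ _ h

/-- Forms of top degree scale by the determinant; here by bilinear expansion in the real basis `1,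
i`. -/
theorem alternating_apply (η : ℂ [⋀^Fin 2]→L[ℝ] ℂ) (T : ℂ →L[ℝ] ℂ) :
    η ![T 1, T Complex.I] = (T.det : ℂ) * η ![1, Complex.I] := by
  have hdet : T.det = (T 1).re * (T Complex.I).im - (T Complex.I).re * (T 1).im := by
    have : T.det = LinearMap.det (T : ℂ →ₗ[ℝ] ℂ) := rfl
    rw [this, ← LinearMap.det_toMatrix Complex.basisOneI, Matrix.det_fin_two]
    simp [LinearMap.toMatrix_apply]
  have hadd1 : ∀ a b w : ℂ, η ![a + b, w] = η ![a, w] + η ![b, w] := fun a b w => by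
    simpa using η.map_vecCons_add ![w] a b
  have hsmul1 : ∀ (c : ℝ) (a w : ℂ), η ![c • a, w] = c • η ![a, w] := fun c a w => by
    simpa using η.map_vecCons_smul ![w] c a
  have hswap : ∀ a b : ℂ, η ![a, b] = - η ![b, a] := fun a b => by
    have h := η.map_swap ![b, a] (i := 0) (j := 1) (by decide)
    refine Eq.trans (congrArg η.toAlternatingMap ?_) h
    funext i
    fin_cases i <;> simp
  have hself : ∀ a : ℂ, η ![a, a] = 0 := fun a =>
    η.map_eq_zero_of_eq ![a, a] (i := 0) (j := 1) rfl (by decide)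
  have hrepr : ∀ a : ℂ, a = a.re • (1 : ℂ) + a.im • Complex.I := fun a => by
    simp
  rw [hdet]
  rw [hrepr (T 1), hadd1, hsmul1, hsmul1, hswap 1, hswap Complex.I,
    hrepr (T Complex.I), hadd1, hsmul1, hsmul1, hadd1, hsmul1, hsmul1, hself, hself,
    hswap Complex.I 1]
  simp
  ring

theorem density_congr {p q : M} {z : ℂ} (hz : z ∈ (transition p q).source) (η : TwoForm M) :
    density p η z =
      ((fderiv ℝ (transition p q) z).det : ℂ) * density q η (transition p q z) := by
  have key : ∀ (x y : M) (hxy : x = y) (v w v' w' : ℂ), v = v' → w = w' →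
      (η x : ℂ [⋀^Fin 2]→L[ℝ] ℂ) ![v, w] = (η y : ℂ [⋀^Fin 2]→L[ℝ] ℂ) ![v', w'] := by
    rintro x _ rfl v w _ _ rfl rfl
    rfl
  let E : ℂ →L[ℝ] ℂ := mfderiv 𝓘(ℝ, ℂ) 𝓘(ℝ, ℂ) (chartAt ℂ q).symm (transition p q z)
  let η' : ℂ [⋀^Fin 2]→L[ℝ] ℂ := η ((chartAt ℂ q).symm (transition p q z))
  have h2 := alternating_apply (η'.compContinuousLinearMap E) (fderiv ℝ (transition p q) z)
  have h3 : ∀ v w : ℂ, η'.compContinuousLinearMap E ![v, w] = η' ![E v, E w] := fun v w => by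
    rw [ContinuousAlternatingMap.compContinuousLinearMap_apply]
    congr 1
    funext i
    fin_cases i <;> rfl
  rw [h3, h3] at h2
  refine (key _ _ (symm_transition hz).symm _ _ _ _ (mfderiv_symm_transition hz 1)
    (mfderiv_symm_transition hz Complex.I)).trans h2

theorem density_self (p : M) (η : TwoForm M) :
    density p η (chartAt ℂ p p) = (η p : ℂ [⋀^Fin 2]→L[ℝ] ℂ) ![(1 : ℂ), Complex.I] := by
  have key : ∀ (x y : M) (hxy : x = y) (v w v' w' : ℂ), v = v' → w = w' →
      (η x : ℂ [⋀^Fin 2]→L[ℝ] ℂ) ![v, w] = (η y : ℂ [⋀^Fin 2]→L[ℝ] ℂ) ![v', w'] := by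
    rintro x _ rfl v w _ _ rfl rfl
    rfl
  exact key _ _ ((chartAt ℂ p).left_inv (mem_chart_source ℂ p)) _ _ _ _ (mfderiv_symm_self p _)
    (mfderiv_symm_self p _)

/-- Any pair of vectors is the image of `(1, i)` under some real linear `T`, so the value on `(1,
i)` determines the form. -/
theorem alternating_ext {η η' : ℂ [⋀^Fin 2]→L[ℝ] ℂ}
    (h : η ![1, Complex.I] = η' ![1, Complex.I]) : η = η' := by
  ext v
  let T : ℂ →L[ℝ] ℂ := Complex.reCLM.smulRight (v 0) + Complex.imCLM.smulRight (v 1)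
  have hv : v = ![T 1, T Complex.I] := by
    funext i
    fin_cases i <;> simp [T]
  rw [hv, alternating_apply, alternating_apply, h]

/-- Two-forms agreeing in the preferred coordinate at `x` agree at `x`. -/
theorem twoForm_eq_of_density {η η' : TwoForm M} {x : M}
    (h : density x η (chartAt ℂ x x) = density x η' (chartAt ℂ x x)) : η x = η' x := by
  rw [density_self, density_self] at h
  exact alternating_ext h

/-- The transition maps of a Riemann surface preserve the orientation. -/
theorem det_fderiv_transition_nonneg {M : Type*} [TopologicalSpace M] [ChartedSpace ℂ M]
    [IsManifold 𝓘(ℂ, ℂ) ω M] {p q : M} {z : ℂ} (hz : z ∈ (transition p q).source) :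
    0 ≤ (fderiv ℝ (transition p q) z).det := by
  have h1 := HasGroupoid.compatible (G := contDiffGroupoid ω 𝓘(ℂ, ℂ))
    (chart_mem_atlas ℂ p) (chart_mem_atlas ℂ q)
  rw [contDiffGroupoid, mem_groupoid_of_pregroupoid] at h1
  have h2 : ContDiffOn ℂ ω (transition p q) (transition p q).source := by
    have h3 := h1.1
    simp only [contDiffPregroupoid, modelWithCornersSelf_coe, modelWithCornersSelf_coe_symm,
      Function.comp_id, Function.id_comp, preimage_id_eq, range_id, inter_univ, id] at h3
    exact h3
  have h4 : DifferentiableAt ℂ (transition p q) z :=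
    ((h2.contDiffAt ((transition p q).open_source.mem_nhds hz)).differentiableAt (by simp))
  have h5 := h4.fderiv_restrictScalars ℝ
  set c := deriv (transition p q) z
  -- A holomorphic map has multiplication by a complex number `c` as derivative, whose real
  -- determinant is `|c|²`.
  have h6 : ∀ v, fderiv ℝ (transition p q) z v = v * c := fun v => by
    rw [h5]
    simp [c]
  have hdet : (fderiv ℝ (transition p q) z).det = LinearMap.det
    ((fderiv ℝ (transition p q) z : ℂ →L[ℝ] ℂ) : ℂ →ₗ[ℝ] ℂ) := rfl
  rw [hdet, ← LinearMap.det_toMatrix Complex.basisOneI, Matrix.det_fin_two]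
  simp [LinearMap.toMatrix_apply, h6]
  nlinarith [mul_self_nonneg c.re, mul_self_nonneg c.im]

end Transition

/-! ### Exterior calculus in charts -/

section Calculus

variable {M : Type*} [TopologicalSpace M] [ChartedSpace ℂ M] [IsManifold 𝓘(ℝ, ℂ) ∞ M]

variable (M) in
/-- Complex valued covector fields, not necessarily smooth. -/
abbrev CovectorField : Type _ := ∀ x : M, TangentSpace 𝓘(ℝ, ℂ) x →L[ℝ] ℂ

/-- Smoothness of a covector field at a point, in the preferred chart there. -/
def SmoothFormAt (α : CovectorField M) (x : M) : Prop :=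
  ContDiffAt ℝ ∞ (chartForm x α) (chartAt ℂ x x)

/-- The coefficient of `dx ∧ dy` in the exterior derivative of a one-form on `ℂ`. -/
def curl (θ : ℂ → ℂ →L[ℝ] ℂ) (z : ℂ) : ℂ :=
  fderiv ℝ θ z 1 Complex.I - fderiv ℝ θ z Complex.I 1

theorem two_le_infty : (2 : ℕ∞ω) ≤ ∞ := by
  rw [show (2 : ℕ∞ω) = ((2 : ℕ∞) : ℕ∞ω) from rfl]
  exact WithTop.coe_le_coe.2 le_top

theorem extDeriv_apply_pair {θ : ℂ → ℂ →L[ℝ] ℂ} {z : ℂ} (h : DifferentiableAt ℝ θ z) :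
    extDeriv (fun z : ℂ => ContinuousAlternatingMap.ofSubsingleton ℝ ℂ ℂ (0 : Fin 1) (θ z)) z
      ![1, Complex.I] = curl θ z := by
  have h1 : HasFDerivAt
      (fun z : ℂ => ContinuousAlternatingMap.ofSubsingleton ℝ ℂ ℂ (0 : Fin 1) (θ z))
      ((ContinuousAlternatingMap.ofSubsingletonLIE (𝕜 := ℝ) (E := ℂ) (F := ℂ) (0 : Fin 1)
        ).toContinuousLinearEquiv.toContinuousLinearMap.comp (fderiv ℝ θ z)) z :=
    ((ContinuousAlternatingMap.ofSubsingletonLIE (𝕜 := ℝ) (E := ℂ) (F := ℂ) (0 : Fin 1)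
      ).toContinuousLinearEquiv.toContinuousLinearMap.hasFDerivAt).comp z h.hasFDerivAt
  have h2 : ∀ v w : ℂ, fderiv ℝ (fun y => θ y v) z w = fderiv ℝ θ z w v := fun v w => by
    have h3 : HasFDerivAt (fun y => θ y v) _ z :=
      ((ContinuousLinearMap.apply ℝ ℂ v).hasFDerivAt).comp z h.hasFDerivAt
    rw [h3.fderiv]
    rfl
  rw [extDeriv_apply h1.differentiableAt]
  simp [Fin.sum_univ_two, curl, Fin.removeNth, h2, ← sub_eq_add_neg]

theorem differentiableAt_ofSubsingleton {θ : ℂ → ℂ →L[ℝ] ℂ} {z : ℂ}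
    (h : DifferentiableAt ℝ θ z) : DifferentiableAt ℝ
      (fun z : ℂ => ContinuousAlternatingMap.ofSubsingleton ℝ ℂ ℂ (0 : Fin 1) (θ z)) z :=
  ((ContinuousAlternatingMap.ofSubsingletonLIE (𝕜 := ℝ) (E := ℂ) (F := ℂ) (0 : Fin 1)
    ).toContinuousLinearEquiv.toContinuousLinearMap.differentiableAt).comp z h

theorem curl_congr {θ θ' : ℂ → ℂ →L[ℝ] ℂ} {z : ℂ} (h : θ =ᶠ[𝓝 z] θ') :
    curl θ z = curl θ' z := by
  rw [curl, curl, h.fderiv_eq]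

/-- Naturality of the exterior derivative under pullback, combined with the scaling of a top-degree
form by the determinant. The product `θ(f) ∘ Df` is differentiated, so second derivatives of `f`
enter and cancel by symmetry. -/
theorem curl_pullback {θ : ℂ → ℂ →L[ℝ] ℂ} {f : ℂ → ℂ} {z : ℂ}
    (hθ : ContDiffAt ℝ ∞ θ (f z)) (hf : ContDiffAt ℝ ∞ f z) :
    curl (fun y => (θ (f y)).comp (fderiv ℝ f y)) z = ((fderiv ℝ f z).det : ℂ) * curl θ (f z) := by
  have hf' : ContDiffAt ℝ ∞ (fderiv ℝ f) z := hf.fderiv_right (by simp)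
  have h1 : ContDiffAt ℝ ∞ (fun y => (θ (f y)).comp (fderiv ℝ f y)) z :=
    (hθ.comp z hf).clm_comp hf'
  have hθd := hθ.differentiableAt (by simp)
  rw [← extDeriv_apply_pair (h1.differentiableAt (by simp)), ← extDeriv_apply_pair hθd]
  have h2 := extDeriv_pullback (differentiableAt_ofSubsingleton hθd) hf (r := ∞) (by
    simpa using two_le_infty)
  have h3 : (fun y => ContinuousAlternatingMap.ofSubsingleton ℝ ℂ ℂ (0 : Fin 1)
      ((θ (f y)).comp (fderiv ℝ f y))) = fun y => (ContinuousAlternatingMap.ofSubsingleton ℝ ℂ ℂ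
      (0 : Fin 1) (θ (f y))).compContinuousLinearMap (fderiv ℝ f y) := by
    funext y
    ext v
    simp
  rw [h3, h2, ← alternating_apply, ContinuousAlternatingMap.compContinuousLinearMap_apply]
  congr 1
  funext i
  fin_cases i <;> rfl

theorem curl_add {θ θ' : ℂ → ℂ →L[ℝ] ℂ} {z : ℂ} (h : DifferentiableAt ℝ θ z)
    (h' : DifferentiableAt ℝ θ' z) : curl (fun y => θ y + θ' y) z = curl θ z + curl θ' z := by
  simp only [curl, fderiv_fun_add h h', add_apply]
  ring

theorem curl_smul {f : ℂ → ℂ} {θ : ℂ → ℂ →L[ℝ] ℂ} {z : ℂ} (hf : DifferentiableAt ℝ f z)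
    (h : DifferentiableAt ℝ θ z) : curl (fun y => f y • θ y) z =
      fderiv ℝ f z 1 * θ z Complex.I - fderiv ℝ f z Complex.I * θ z 1 + f z * curl θ z := by
  simp only [curl, fderiv_fun_smul hf h, add_apply,
    smul_apply, ContinuousLinearMap.smulRight_apply, smul_eq_mul]
  ring

theorem curl_fderiv {f : ℂ → ℂ} {z : ℂ} (hf : ContDiffAt ℝ ∞ f z) : curl (fderiv ℝ f) z = 0 := by
  rw [curl, sub_eq_zero]
  exact (hf.isSymmSndFDerivAt (by simpa using two_le_infty)).eq 1 Complex.I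

theorem contDiffAt_curl {θ : ℂ → ℂ →L[ℝ] ℂ} {z : ℂ} (h : ContDiffAt ℝ ∞ θ z) :
    ContDiffAt ℝ ∞ (curl θ) z := by
  have h1 : ContDiffAt ℝ ∞ (fderiv ℝ θ) z := h.fderiv_right (by simp)
  have h2 : ∀ v w : ℂ, ContDiffAt ℝ ∞ (fun y => fderiv ℝ θ y v w) z := fun v w =>
    (h1.clm_apply contDiffAt_const).clm_apply contDiffAt_const
  exact (h2 _ _).sub (h2 _ _)

theorem chart_symm_mem_source {p : M} {z : ℂ} (hz : z ∈ (chartAt ℂ p).target) (x : M)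
    (hx : (chartAt ℂ p).symm z = x) : z ∈ (transition p x).source := by
  subst hx
  exact mem_transition_source.2 ⟨hz, mem_chart_source ℂ _⟩

/-- `SmoothFormAt` refers to the chart centred at the point; the pullback formula for transition
maps carries smoothness to any other chart. -/
theorem contDiffAt_chartForm {α : CovectorField M} {p : M} {z : ℂ}
    (hz : z ∈ (chartAt ℂ p).target) (h : SmoothFormAt α ((chartAt ℂ p).symm z)) :
    ContDiffAt ℝ ∞ (chartForm p α) z := by
  set x := (chartAt ℂ p).symm z with hx
  have hs := chart_symm_mem_source hz x rfl
  have hτ := contDiffAt_transition hs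
  have h1 : ContDiffAt ℝ ∞ (chartForm x α) (transition p x z) := h
  have h2 : ContDiffAt ℝ ∞ (fderiv ℝ (transition p x)) z := hτ.fderiv_right (by simp)
  refine ((h1.comp z hτ).clm_comp h2).congr_of_eventuallyEq ?_
  filter_upwards [(transition p x).open_source.mem_nhds hs] with y hy
  exact chartForm_congr hy α

theorem density_extD_self {α : CovectorField M} {x : M} (h : SmoothFormAt α x) :
    density x (extD α) (chartAt ℂ x x) = curl (chartForm x α) (chartAt ℂ x x) := by
  rw [density_self, ← extDeriv_apply_pair (ContDiffAt.differentiableAt h (by simp))]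
  have h1 := mfderiv_extChartAt_self (I := 𝓘(ℝ, ℂ)) (x := x)
  simp only [mfld_simps] at h1
  have h2 : ∀ v : ℂ, (mfderiv 𝓘(ℝ, ℂ) 𝓘(ℝ, ℂ) (chartAt ℂ x) x v : ℂ) = v := fun v =>
    congrArg (fun T : ℂ →L[ℝ] ℂ => T v) h1
  have h4 : ∀ (ξ : ℂ [⋀^Fin 2]→L[ℝ] ℂ) (T : ℂ →L[ℝ] ℂ), (∀ v, T v = v) →
      ξ.compContinuousLinearMap T ![1, Complex.I] = ξ ![1, Complex.I] := fun ξ T hT => by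
    rw [ContinuousAlternatingMap.compContinuousLinearMap_apply]
    congr 1
    funext i
    exact hT _
  exact h4 _ _ h2

/-- The density of `dα` is the curl of the coordinate expression of `α`. -/
theorem density_extD {α : CovectorField M} {p : M} {z : ℂ}
    (hz : z ∈ (chartAt ℂ p).target) (h : SmoothFormAt α ((chartAt ℂ p).symm z)) :
    density p (extD α) z = curl (chartForm p α) z := by
  set x := (chartAt ℂ p).symm z with hx
  have hs := chart_symm_mem_source hz x rfl
  have h1 : ContDiffAt ℝ ∞ (chartForm x α) (transition p x z) := h
  have h3 : chartForm p α =ᶠ[𝓝 z]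
      fun y => (chartForm x α (transition p x y)).comp (fderiv ℝ (transition p x) y) := by
    filter_upwards [(transition p x).open_source.mem_nhds hs] with y hy
    exact chartForm_congr hy α
  rw [density_congr hs, curl_congr h3, curl_pullback h1 (contDiffAt_transition hs)]
  congr 1
  exact density_extD_self h

theorem contMDiffAt_chart_symm {p : M} {z : ℂ} (hz : z ∈ (chartAt ℂ p).target) :
    ContMDiffAt 𝓘(ℝ, ℂ) 𝓘(ℝ, ℂ) ∞ (chartAt ℂ p).symm z :=
  (contMDiffOn_chart_symm (I := 𝓘(ℝ, ℂ)) z hz).contMDiffAt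
    ((chartAt ℂ p).open_target.mem_nhds hz)

theorem contMDiffAt_chart {p x : M} (hx : x ∈ (chartAt ℂ p).source) :
    ContMDiffAt 𝓘(ℝ, ℂ) 𝓘(ℝ, ℂ) ∞ (chartAt ℂ p) x :=
  (contMDiffOn_chart (I := 𝓘(ℝ, ℂ)) x hx).contMDiffAt
    ((chartAt ℂ p).open_source.mem_nhds hx)

theorem contDiffAt_comp_symm {F : Type*} [NormedAddCommGroup F] [NormedSpace ℝ F] {f : M → F}
    {p : M} {z : ℂ} (hz : z ∈ (chartAt ℂ p).target)
    (h : ContMDiffAt 𝓘(ℝ, ℂ) 𝓘(ℝ, F) ∞ f ((chartAt ℂ p).symm z)) :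
    ContDiffAt ℝ ∞ (fun y => f ((chartAt ℂ p).symm y)) z :=
  (h.comp z (contMDiffAt_chart_symm hz)).contDiffAt

theorem contMDiffAt_of_comp_symm {F : Type*} [NormedAddCommGroup F] [NormedSpace ℝ F] {f : M → F}
    {p x : M} (hx : x ∈ (chartAt ℂ p).source)
    (h : ContDiffAt ℝ ∞ (fun y => f ((chartAt ℂ p).symm y)) (chartAt ℂ p x)) :
    ContMDiffAt 𝓘(ℝ, ℂ) 𝓘(ℝ, F) ∞ f x := by
  refine (h.contMDiffAt.comp x (contMDiffAt_chart hx)).congr_of_eventuallyEq ?_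
  filter_upwards [(chartAt ℂ p).open_source.mem_nhds hx] with y hy
  simp [(chartAt ℂ p).left_inv hy]

/-- The tangent trivialization at `x₀` is given by the derivative of the chart there, so bundle
coordinates of a covector field coincide with its `chartForm` near the centre. -/
theorem smoothFormAt_of_contMDiffAt {α : CovectorField M} {x₀ : M}
    (h : ContMDiffAt 𝓘(ℝ, ℂ) (𝓘(ℝ, ℂ).prod 𝓘(ℝ, ℂ →L[ℝ] ℂ)) ∞
      (fun x => (TotalSpace.mk' (ℂ →L[ℝ] ℂ) x (α x) :
        TotalSpace (ℂ →L[ℝ] ℂ) (fun x : M => TangentSpace 𝓘(ℝ, ℂ) x →L[ℝ] ℂ))) x₀) :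
    SmoothFormAt α x₀ := by
  rw [contMDiffAt_oneForm_iff] at h
  have hz : chartAt ℂ x₀ x₀ ∈ (chartAt ℂ x₀).target := mem_chart_target ℂ x₀
  rw [← (chartAt ℂ x₀).left_inv (mem_chart_source ℂ x₀)] at h
  refine (contDiffAt_comp_symm hz h).congr_of_eventuallyEq ?_
  filter_upwards [(chartAt ℂ x₀).open_target.mem_nhds hz] with z hz
  have h1 := TangentBundle.symmL_trivializationAt (I := 𝓘(ℝ, ℂ))
    ((chartAt ℂ x₀).map_target hz)
  simp only [mfld_simps] at h1
  rw [(chartAt ℂ x₀).right_inv hz] at h1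
  ext1 v
  rw [(chartAt ℂ x₀).left_inv (mem_chart_source ℂ x₀)]
  exact congrArg (fun T : ℂ →L[ℝ] ℂ => (α ((chartAt ℂ x₀).symm z) : ℂ →L[ℝ] ℂ) (T v)) h1.symm

theorem OneForm.smoothFormAt (α : OneForm M) (x : M) : SmoothFormAt (fun y => α y) x :=
  smoothFormAt_of_contMDiffAt (α.contMDiff x)

theorem SmoothFormAt.add {α β : CovectorField M} {x : M} (hα : SmoothFormAt α x)
    (hβ : SmoothFormAt β x) : SmoothFormAt (fun y => α y + β y) x :=
  ContDiffAt.add hα hβ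

theorem SmoothFormAt.smul {f : M → ℂ} {α : CovectorField M} {x : M}
    (hf : ContMDiffAt 𝓘(ℝ, ℂ) 𝓘(ℝ, ℂ) ∞ f x)
    (hα : SmoothFormAt α x) : SmoothFormAt (fun y => f y • α y) x := by
  rw [← (chartAt ℂ x).left_inv (mem_chart_source ℂ x)] at hf
  exact ContDiffAt.smul (contDiffAt_comp_symm (mem_chart_target ℂ x) hf) hα

theorem SmoothFormAt.congr {α β : CovectorField M} {x : M} (hα : SmoothFormAt α x)
    (h : ∀ᶠ y in 𝓝 x, β y = α y) : SmoothFormAt β x := by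
  refine ContDiffAt.congr_of_eventuallyEq hα ?_
  have h1 : Tendsto (chartAt ℂ x).symm (𝓝 (chartAt ℂ x x)) (𝓝 x) := by
    have := (chartAt ℂ x).symm.continuousAt (mem_chart_target ℂ x)
    rwa [ContinuousAt, (chartAt ℂ x).left_inv (mem_chart_source ℂ x)] at this
  filter_upwards [h1.eventually h] with z hz
  simp only [chartForm, hz]

/-- Locality of `d`. It is needed because connection forms and their changes of frame are meaningful
only near a point. -/
theorem extD_congr {α β : CovectorField M} {x : M}
    (h : ∀ᶠ y in 𝓝 x, β y = α y) : extD β x = extD α x := by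
  have h1 : Tendsto (chartAt ℂ x).symm (𝓝 (chartAt ℂ x x)) (𝓝 x) := by
    have := (chartAt ℂ x).symm.continuousAt (mem_chart_target ℂ x)
    rwa [ContinuousAt, (chartAt ℂ x).left_inv (mem_chart_source ℂ x)] at this
  have h2 : (fun z : ℂ => ContinuousAlternatingMap.ofSubsingleton ℝ ℂ ℂ (0 : Fin 1)
      (chartForm x β z)) =ᶠ[𝓝 (chartAt ℂ x x)] fun z : ℂ =>
      ContinuousAlternatingMap.ofSubsingleton ℝ ℂ ℂ (0 : Fin 1) (chartForm x α z) := by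
    filter_upwards [h1.eventually h] with z hz
    simp only [chartForm, hz]
  rw [extD, extD, h2.extDeriv_eq]

theorem chartForm_mvfderiv {f : M → ℂ} {p : M} {z : ℂ} (hz : z ∈ (chartAt ℂ p).target)
    (hf : MDifferentiableAt 𝓘(ℝ, ℂ) 𝓘(ℝ, ℂ) f ((chartAt ℂ p).symm z)) :
    chartForm p (mvfderiv 𝓘(ℝ, ℂ) f) z = fderiv ℝ (fun y => f ((chartAt ℂ p).symm y)) z := by
  have h1 := mfderiv_comp z hf (mdifferentiableAt_chart_symm hz)
  rw [mfderiv_eq_fderiv] at h1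
  exact h1.symm

theorem chartForm_mvfderiv_eventuallyEq {f : M → ℂ} {x : M}
    (hf : ∀ᶠ y in 𝓝 x, ContMDiffAt 𝓘(ℝ, ℂ) 𝓘(ℝ, ℂ) ∞ f y) :
    chartForm x (mvfderiv 𝓘(ℝ, ℂ) f) =ᶠ[𝓝 (chartAt ℂ x x)]
      fderiv ℝ (fun y => f ((chartAt ℂ x).symm y)) := by
  have h1 : Tendsto (chartAt ℂ x).symm (𝓝 (chartAt ℂ x x)) (𝓝 x) := by
    have := (chartAt ℂ x).symm.continuousAt (mem_chart_target ℂ x)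
    rwa [ContinuousAt, (chartAt ℂ x).left_inv (mem_chart_source ℂ x)] at this
  filter_upwards [h1.eventually hf,
    (chartAt ℂ x).open_target.mem_nhds (mem_chart_target ℂ x)] with z hz hz'
  exact chartForm_mvfderiv hz' (hz.mdifferentiableAt (by simp))

theorem smoothFormAt_mvfderiv {f : M → ℂ} {x : M}
    (hf : ∀ᶠ y in 𝓝 x, ContMDiffAt 𝓘(ℝ, ℂ) 𝓘(ℝ, ℂ) ∞ f y) :
    SmoothFormAt (mvfderiv 𝓘(ℝ, ℂ) f) x := by
  have h2 := hf.self_of_nhds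
  rw [← (chartAt ℂ x).left_inv (mem_chart_source ℂ x)] at h2
  have h3 : ContDiffAt ℝ ∞ (fderiv ℝ (fun y => f ((chartAt ℂ x).symm y))) (chartAt ℂ x x) :=
    (contDiffAt_comp_symm (mem_chart_target ℂ x) h2).fderiv_right (by simp)
  exact h3.congr_of_eventuallyEq (chartForm_mvfderiv_eventuallyEq hf)

theorem extD_add {α β : CovectorField M} {x : M} (hα : SmoothFormAt α x)
    (hβ : SmoothFormAt β x) : extD (fun y => α y + β y) x = extD α x + extD β x := by
  -- `twoForm_eq_of_density` compares two-forms given on all of `M`, so the right-hand side is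
  -- extended by its formula to every point; only its value at `x` matters.
  refine twoForm_eq_of_density (η' := fun x => extD α x + extD β x) ?_
  rw [density_extD_self (hα.add hβ)]
  refine (curl_add (ContDiffAt.differentiableAt hα (by simp))
    (ContDiffAt.differentiableAt hβ (by simp))).trans ?_
  rw [← density_extD_self hα, ← density_extD_self hβ]
  rfl

theorem density_wedgeAt (α β : CovectorField M) (p : M) (z : ℂ) :
    density p (fun x => wedgeAt (α x) (β x)) z =
      chartForm p α z 1 * chartForm p β z Complex.I -
        chartForm p α z Complex.I * chartForm p β z 1 := rfl

theorem extD_smul {f : M → ℂ} {α : CovectorField M} {x : M}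
    (hf : ContMDiffAt 𝓘(ℝ, ℂ) 𝓘(ℝ, ℂ) ∞ f x) (hα : SmoothFormAt α x) :
    extD (fun y => f y • α y) x =
      wedgeAt (mvfderiv 𝓘(ℝ, ℂ) f x) (α x) + f x • extD α x := by
  refine twoForm_eq_of_density
    (η' := fun x => wedgeAt (mvfderiv 𝓘(ℝ, ℂ) f x) (α x) + f x • extD α x) ?_
  rw [density_extD_self (hα.smul hf)]
  have hf' := hf
  rw [← (chartAt ℂ x).left_inv (mem_chart_source ℂ x)] at hf'
  refine (curl_smul ((contDiffAt_comp_symm (mem_chart_target ℂ x) hf').differentiableAt (by simp))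
    (ContDiffAt.differentiableAt hα (by simp))).trans ?_
  rw [← chartForm_mvfderiv (mem_chart_target ℂ x) (hf'.mdifferentiableAt (by simp)),
    ← density_extD_self hα, ← density_wedgeAt]
  rfl

/-- A logarithmic derivative is closed. -/
theorem extD_inv_smul_mvfderiv {f : M → ℂ} {x : M}
    (hf : ∀ᶠ y in 𝓝 x, ContMDiffAt 𝓘(ℝ, ℂ) 𝓘(ℝ, ℂ) ∞ f y) (h0 : f x ≠ 0) :
    SmoothFormAt (fun y => (f y)⁻¹ • mvfderiv 𝓘(ℝ, ℂ) f y) x ∧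
      extD (fun y => (f y)⁻¹ • mvfderiv 𝓘(ℝ, ℂ) f y) x = 0 := by
  have hx := hf.self_of_nhds
  have hinv : ContMDiffAt 𝓘(ℝ, ℂ) 𝓘(ℝ, ℂ) ∞ (fun y => (f y)⁻¹) x :=
    (contDiffAt_inv ℝ h0).contMDiffAt.comp x hx
  have hs := (smoothFormAt_mvfderiv hf).smul hinv
  refine ⟨hs, ?_⟩
  refine twoForm_eq_of_density (η' := 0) ?_
  rw [density_extD_self hs]
  have hf' := hx
  rw [← (chartAt ℂ x).left_inv (mem_chart_source ℂ x)] at hf'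
  have hg := contDiffAt_comp_symm (mem_chart_target ℂ x) hf'
  set g := fun y => f ((chartAt ℂ x).symm y) with hgdef
  have hg0 : g (chartAt ℂ x x) ≠ 0 := by
    simpa [hgdef, (chartAt ℂ x).left_inv (mem_chart_source ℂ x)] using h0
  have h1 : chartForm x (fun y => (f y)⁻¹ • mvfderiv 𝓘(ℝ, ℂ) f y) =ᶠ[𝓝 (chartAt ℂ x x)]
      fun z => (g z)⁻¹ • fderiv ℝ g z := by
    filter_upwards [chartForm_mvfderiv_eventuallyEq hf] with z hz
    rw [← hz]
    rfl
  have hg' : ContDiffAt ℝ ∞ (fderiv ℝ g) (chartAt ℂ x x) := hg.fderiv_right (by simp)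
  have hgd := hg.differentiableAt (by simp)
  have hi : HasFDerivAt (fun z => (g z)⁻¹) _ (chartAt ℂ x x) :=
    ((hasDerivAt_inv hg0).hasFDerivAt.restrictScalars ℝ).comp _ hgd.hasFDerivAt
  -- The curl of `g⁻¹ dg` has two parts: `d(g⁻¹) ∧ dg`, a multiple of `dg ∧ dg = 0`, and `g⁻¹
  -- d(dg)`, zero by symmetry of second derivatives. No logarithm of `g` is chosen.
  rw [curl_congr h1, curl_smul hi.differentiableAt (hg'.differentiableAt (by simp)),
    curl_fderiv hg, hi.fderiv]
  have h0 : density x (0 : TwoForm M) (chartAt ℂ x x) = 0 := rfl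
  rw [h0]
  simp
  ring

end Calculus

/-! ### Smooth two-forms -/

section TwoForms

variable {M : Type*} [TopologicalSpace M] [ChartedSpace ℂ M] [IsManifold 𝓘(ℝ, ℂ) ∞ M]

theorem TwoForm.IsSmooth.add {η η' : TwoForm M} (h : η.IsSmooth) (h' : η'.IsSmooth) :
    TwoForm.IsSmooth (fun x => η x + η' x) := fun p => (h p).add (h' p)

theorem TwoForm.IsSmooth.sub {η η' : TwoForm M} (h : η.IsSmooth) (h' : η'.IsSmooth) :
    TwoForm.IsSmooth (fun x => η x - η' x) := fun p => (h p).sub (h' p)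

theorem contDiffOn_comp_symm {F : Type*} [NormedAddCommGroup F] [NormedSpace ℝ F] {f : M → F}
    (hf : ContMDiff 𝓘(ℝ, ℂ) 𝓘(ℝ, F) ∞ f) (p : M) :
    ContDiffOn ℝ ∞ (fun z => f ((chartAt ℂ p).symm z)) (chartAt ℂ p).target := fun _ hz =>
  (contDiffAt_comp_symm hz (hf _)).contDiffWithinAt

theorem TwoForm.IsSmooth.smul {f : M → ℂ} {η : TwoForm M}
    (hf : ContMDiff 𝓘(ℝ, ℂ) 𝓘(ℝ, ℂ) ∞ f) (h : η.IsSmooth) :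
    TwoForm.IsSmooth (fun x => f x • η x) := fun p => (contDiffOn_comp_symm hf p).mul (h p)

theorem isSmooth_wedge (α β : OneForm M) : TwoForm.IsSmooth (wedge α β) := by
  intro p z hz
  have h1 : ∀ (γ : OneForm M) (v : ℂ), ContDiffAt ℝ ∞ (fun y => chartForm p (fun x => γ x) y v) z :=
    fun γ v => (contDiffAt_chartForm hz (γ.smoothFormAt _)).clm_apply contDiffAt_const
  exact (((h1 α _).mul (h1 β _)).sub ((h1 α _).mul (h1 β _))).contDiffWithinAt

theorem isSmooth_extD {α : CovectorField M} (h : ∀ x, SmoothFormAt α x) :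
    TwoForm.IsSmooth (extD α) := by
  intro p z hz
  refine ContDiffAt.contDiffWithinAt ?_
  refine (contDiffAt_curl (contDiffAt_chartForm hz (h _))).congr_of_eventuallyEq ?_
  filter_upwards [(chartAt ℂ p).open_target.mem_nhds hz] with y hy
  exact density_extD hy (h _)

end TwoForms

/-! ### Integration -/

/-- The open sets `U` and the complement of `K` cover the space; the extension by zero equals `h` on
the first and `0` on the second. -/
theorem contDiff_indicator {E F : Type*} [NormedAddCommGroup E] [NormedSpace ℝ E]
    [NormedAddCommGroup F] [NormedSpace ℝ F] {n : ℕ∞ω} {h : E → F} {U K : Set E}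
    (hU : IsOpen U) (hK : IsCompact K) (hKU : K ⊆ U) (h0 : ∀ z ∈ U, z ∉ K → h z = 0)
    (hh : ContDiffOn ℝ n h U) :
    ContDiff ℝ n (U.indicator h) ∧ HasCompactSupport (U.indicator h) := by
  have h1 : ∀ z, z ∉ K → U.indicator h z = 0 := fun z hz => by
    by_cases hzU : z ∈ U
    · rw [indicator_of_mem hzU, h0 z hzU hz]
    · exact indicator_of_notMem hzU h
  refine ⟨contDiff_iff_contDiffAt.2 fun z => ?_, HasCompactSupport.intro hK h1⟩
  by_cases hz : z ∈ U
  · refine (hh.contDiffAt (hU.mem_nhds hz)).congr_of_eventuallyEq ?_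
    filter_upwards [hU.mem_nhds hz] with y hy
    exact indicator_of_mem hy h
  · refine (contDiffAt_const (c := (0 : F))).congr_of_eventuallyEq ?_
    filter_upwards [hK.isClosed.isOpen_compl.mem_nhds fun hzK => hz (hKU hzK)] with y hy
    exact h1 y hy

/-- Integration by parts against the constant function `1`. -/
theorem integral_fderiv_eq_zero {θ : ℂ → ℂ} (hθ : ContDiff ℝ ∞ θ) (hc : HasCompactSupport θ)
    (v : ℂ) : ∫ z, fderiv ℝ θ z v = 0 := by
  have hd : Continuous fun z => fderiv ℝ θ z v :=
    (hθ.continuous_fderiv (by simp)).clm_apply continuous_const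
  have h := integral_mul_fderiv_eq_neg_fderiv_mul_of_integrable (μ := volume)
    (f := fun _ : ℂ => (1 : ℂ)) (g := θ) (v := v) (by simp)
    (by simpa using hd.integrable_of_hasCompactSupport (hc.fderiv_apply (𝕜 := ℝ) v))
    (by simpa using hθ.continuous.integrable_of_hasCompactSupport hc)
    (fun _ _ => differentiableAt_const _)
    (fun _ _ => (hθ.differentiable (by simp)).differentiableAt)
  simpa using h

section Integration

variable {M : Type*} [TopologicalSpace M] [T2Space M] [CompactSpace M] [ChartedSpace ℂ M]

section Real

variable [IsManifold 𝓘(ℝ, ℂ) ∞ M]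

theorem tsupport_chartPartition_subset (p : M) :
    tsupport (chartPartition M p) ⊆ (chartAt ℂ p).source :=
  (SmoothPartitionOfUnity.exists_isSubordinate_chartAt_source 𝓘(ℝ, ℂ) M).choose_spec p

theorem chartPartition_eq_zero {p x : M} (hx : x ∉ (chartAt ℂ p).source) :
    chartPartition M p x = 0 :=
  image_eq_zero_of_notMem_tsupport fun h => hx (tsupport_chartPartition_subset p h)

variable (M) in
theorem finite_chartPartition : {p : M | (Function.support (chartPartition M p)).Nonempty}.Finite :=
  (chartPartition M).locallyFinite.finite_nonempty_of_compact

variable (M) in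
/-- The finitely many charts that contribute to the partition of unity. -/
def partitionIndex : Finset M := (finite_chartPartition M).toFinset

theorem chartPartition_of_notMem {p : M} (hp : p ∉ partitionIndex M) (x : M) :
    chartPartition M p x = 0 := by
  by_contra h
  exact hp ((finite_chartPartition M).mem_toFinset.2 ⟨x, h⟩)

theorem sum_chartPartition (x : M) : ∑ p ∈ partitionIndex M, chartPartition M p x = 1 := by
  rw [← (chartPartition M).sum_eq_one (mem_univ x), finsum_eq_sum_of_support_subset]
  intro p hp
  by_contra h
  exact hp (chartPartition_of_notMem h x)

theorem contMDiff_chartPartition (p : M) :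
    ContMDiff 𝓘(ℝ, ℂ) 𝓘(ℝ, ℂ) ∞ (fun x => ((chartPartition M p x : ℝ) : ℂ)) :=
  Complex.ofRealCLM.contDiff.contMDiff.comp (chartPartition M p).contMDiff

theorem integral_eq_sum (η : TwoForm M) :
    integral η = ∑ p ∈ partitionIndex M, ∫ z in (chartAt ℂ p).target,
      ((chartPartition M p ((chartAt ℂ p).symm z) : ℝ) : ℂ) * density p η z := by
  rw [integral, finsum_eq_sum_of_support_subset]
  intro p hp
  by_contra h
  exact hp (by simp [chartPartition_of_notMem h])

theorem isCompact_image_chart {p : M} {K : Set M} (hK : IsClosed K)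
    (hKp : K ⊆ (chartAt ℂ p).source) : IsCompact (chartAt ℂ p '' K) ∧
      chartAt ℂ p '' K ⊆ (chartAt ℂ p).target :=
  ⟨hK.isCompact.image_of_continuousOn ((chartAt ℂ p).continuousOn.mono hKp),
    image_subset_iff.2 fun _ hx => (chartAt ℂ p).map_source (hKp hx)⟩

theorem symm_notMem_of_notMem_image {p : M} {K : Set M} {z : ℂ}
    (hz : z ∈ (chartAt ℂ p).target) (hzK : z ∉ chartAt ℂ p '' K) :
    (chartAt ℂ p).symm z ∉ K := fun h =>
  hzK ⟨_, h, (chartAt ℂ p).right_inv hz⟩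

theorem density_eq_zero {p : M} {η : TwoForm M} {z : ℂ} (h : η ((chartAt ℂ p).symm z) = 0) :
    density p η z = 0 := by
  rw [density, h]
  rfl

theorem integrableOn_density {p : M} {K : Set M} (hK : IsClosed K)
    (hKp : K ⊆ (chartAt ℂ p).source) {η : TwoForm M} (hη : η.IsSmooth)
    (h0 : ∀ x ∉ K, η x = 0) : IntegrableOn (density p η) (chartAt ℂ p).target := by
  obtain ⟨h1, h2⟩ := isCompact_image_chart hK hKp
  obtain ⟨h3, h4⟩ := contDiff_indicator (chartAt ℂ p).open_target h1 h2
    (fun z hz hzK => density_eq_zero (h0 _ (symm_notMem_of_notMem_image hz hzK))) (hη p)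
  exact (integrable_indicator_iff (chartAt ℂ p).open_target.measurableSet).1
    (h3.continuous.integrable_of_hasCompactSupport h4)

/-- The partition function belongs to `p` while the integral is taken in the chart at `q`; this
mixed form is what the comparison of charts requires. -/
theorem integrableOn_piece {η : TwoForm M} (hη : η.IsSmooth) (p q : M)
    {K : Set M} (hK : IsClosed K) (hKq : K ⊆ (chartAt ℂ q).source)
    (h0 : ∀ x ∉ K, (chartPartition M p x : ℂ) • η x = 0) :
    IntegrableOn (fun z => ((chartPartition M p ((chartAt ℂ q).symm z) : ℝ) : ℂ) * density q η z)
      (chartAt ℂ q).target :=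
  integrableOn_density hK hKq (hη.smul (contMDiff_chartPartition p)) h0

theorem integrableOn_partition {η : TwoForm M} (hη : η.IsSmooth) (p : M) :
    IntegrableOn (fun z => ((chartPartition M p ((chartAt ℂ p).symm z) : ℝ) : ℂ) * density p η z)
      (chartAt ℂ p).target :=
  integrableOn_piece hη p p (isClosed_tsupport _) (tsupport_chartPartition_subset p)
    fun x hx => by
      rw [image_eq_zero_of_notMem_tsupport hx, Complex.ofReal_zero]
      exact zero_smul ℂ (η x : ℂ [⋀^Fin 2]→L[ℝ] ℂ)

theorem integral_add {η η' : TwoForm M} (h : η.IsSmooth) (h' : η'.IsSmooth) :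
    integral (fun x => η x + η' x) = integral η + integral η' := by
  simp only [integral_eq_sum, ← Finset.sum_add_distrib]
  refine Finset.sum_congr rfl fun p _ => ?_
  rw [← MeasureTheory.integral_add (integrableOn_partition h p) (integrableOn_partition h' p)]
  congr 1
  funext z
  rw [← mul_add]
  rfl

theorem integral_const_smul (c : ℂ) (η : TwoForm M) :
    integral (fun x => c • η x) = c * integral η := by
  simp only [integral_eq_sum, Finset.mul_sum]
  refine Finset.sum_congr rfl fun p _ => ?_
  rw [← MeasureTheory.integral_const_mul]
  congr 1
  funext z
  rw [mul_left_comm]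
  rfl

theorem integral_zero : integral (fun _ => 0 : TwoForm M) = 0 := by
  have h := integral_const_smul (M := M) 0 (fun _ => 0)
  rw [zero_mul] at h
  refine Eq.trans (congrArg integral ?_) h
  funext x
  exact (smul_zero (A := ℂ [⋀^Fin 2]→L[ℝ] ℂ) (0 : ℂ)).symm

theorem integral_sum {ι : Type*} (s : Finset ι) (η : ι → TwoForm M)
    (h : ∀ i ∈ s, (η i).IsSmooth) :
    TwoForm.IsSmooth (fun x => ∑ i ∈ s, η i x) ∧
      integral (fun x => ∑ i ∈ s, η i x) = ∑ i ∈ s, integral (η i) := by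
  classical
  induction s using Finset.induction_on with
  | empty =>
    simp only [Finset.sum_empty, integral_zero, and_true]
    exact fun p => contDiffOn_const (c := (0 : ℂ))
  | insert a s ha ih =>
    obtain ⟨h1, h2⟩ := ih fun i hi => h i (Finset.mem_insert_of_mem hi)
    have h3 := h a (Finset.mem_insert_self a s)
    simp only [Finset.sum_insert ha]
    exact ⟨h3.add h1, by rw [integral_add h3 h1, h2]⟩

end Real

/-! ### Independence of the chart and Stokes' theorem, where the orientation enters -/

variable [IsManifold 𝓘(ℂ, ℂ) ω M]

/-- The integral of a two-form supported in a chart is computed in that chart. -/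
theorem integral_of_support {q : M} {K : Set M} (hK : IsClosed K)
    (hKq : K ⊆ (chartAt ℂ q).source) {η : TwoForm M} (hη : η.IsSmooth)
    (h0 : ∀ x ∉ K, η x = 0) : integral η = ∫ z in (chartAt ℂ q).target, density q η z := by
  have key : ∀ p : M, ∫ z in (chartAt ℂ p).target,
      ((chartPartition M p ((chartAt ℂ p).symm z) : ℝ) : ℂ) * density p η z =
      ∫ z in (chartAt ℂ q).target,
        ((chartPartition M p ((chartAt ℂ q).symm z) : ℝ) : ℂ) * density q η z := by
    intro p
    -- Both integrals are cut down to the overlap of the charts, for different reasons: in the chart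
    -- at `p` the form vanishes outside `K`, which lies in the chart at `q`; in the chart at `q` the
    -- partition function of `p` vanishes outside the chart at `p`.
    have h1 : ∫ z in (chartAt ℂ p).target,
        ((chartPartition M p ((chartAt ℂ p).symm z) : ℝ) : ℂ) * density p η z =
        ∫ z in (transition p q).source,
          ((chartPartition M p ((chartAt ℂ p).symm z) : ℝ) : ℂ) * density p η z := by
      refine (setIntegral_eq_of_subset_of_forall_sdiff_eq_zero
        (chartAt ℂ p).open_target.measurableSet
        (fun z hz => (mem_transition_source.1 hz).1) fun z hz => ?_)
      have : (chartAt ℂ p).symm z ∉ K := fun h =>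
        hz.2 (mem_transition_source.2 ⟨hz.1, hKq h⟩)
      rw [density_eq_zero (h0 _ this), mul_zero]
    have h2 : ∫ z in (chartAt ℂ q).target,
        ((chartPartition M p ((chartAt ℂ q).symm z) : ℝ) : ℂ) * density q η z =
        ∫ z in (transition p q).target,
          ((chartPartition M p ((chartAt ℂ q).symm z) : ℝ) : ℂ) * density q η z := by
      refine (setIntegral_eq_of_subset_of_forall_sdiff_eq_zero
        (chartAt ℂ q).open_target.measurableSet
        (fun z hz => (mem_transition_target.1 hz).1) fun z hz => ?_)
      have : (chartAt ℂ q).symm z ∉ (chartAt ℂ p).source := fun h =>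
        hz.2 (mem_transition_target.2 ⟨hz.1, h⟩)
      rw [chartPartition_eq_zero this]
      simp
    -- The change of variables produces the absolute value of the determinant, the density the
    -- determinant itself; holomorphy makes them equal.
    rw [h1, h2, integral_target_eq_integral_abs_det_fderiv_smul volume
      (fun z hz => (differentiableAt_transition hz).hasFDerivAt)]
    refine setIntegral_congr_fun (transition p q).open_source.measurableSet fun z hz => ?_
    simp only [density_congr hz, symm_transition hz, abs_of_nonneg (det_fderiv_transition_nonneg hz),
      Complex.real_smul]
    ring
  rw [integral_eq_sum, Finset.sum_congr rfl fun p _ => key p, ← integral_finsetSum]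
  · congr 1
    funext z
    rw [← Finset.sum_mul, ← Complex.ofReal_sum, sum_chartPartition]
    simp
  · intro p _
    exact integrableOn_piece hη p q hK hKq fun x hx => by
      rw [h0 x hx]
      exact smul_zero (M := ℂ) (A := ℂ [⋀^Fin 2]→L[ℝ] ℂ) _

/-- Product of a smooth function and a one-form. -/
def smulForm {f : M → ℂ} (hf : ContMDiff 𝓘(ℝ, ℂ) 𝓘(ℝ, ℂ) ∞ f) (α : OneForm M) : OneForm M :=
  ⟨fun x => f x • α x, contMDiff_smul_oneForm hf α.contMDiff⟩

/-- The exterior derivative as an additive map. -/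
def extDLinear : OneForm M →+ TwoForm M where
  toFun α := extD (fun x => α x)
  map_zero' := by
    have h := (0 : OneForm M).smoothFormAt
    funext x
    have h1 := extD_add (h x) (h x)
    have h2 : (fun y => (0 : OneForm M) y + (0 : OneForm M) y) = fun y => (0 : OneForm M) y := by
      funext y
      simp
    rw [h2] at h1
    simpa using h1
  map_add' α β := by
    funext x
    exact extD_add (α.smoothFormAt x) (β.smoothFormAt x)

/-- Stokes' theorem inside one chart: the coefficients of `α` extend by zero to smooth compactly
supported functions on the plane, and the density of `dα` is a difference of their partial
derivatives. -/
theorem integral_extD_of_support {q : M} {K : Set M} (hK : IsClosed K)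
    (hKq : K ⊆ (chartAt ℂ q).source) (α : OneForm M) (h0 : ∀ x ∉ K, α x = 0) :
    integral (extD fun x => α x) = 0 := by
  have hs := isSmooth_extD α.smoothFormAt
  have h1 : ∀ x ∉ K, extD (fun x => α x) x = 0 := fun x hx => by
    have h2 : ∀ᶠ y in 𝓝 x, α y = (0 : OneForm M) y := by
      filter_upwards [hK.isOpen_compl.mem_nhds hx] with y hy
      rw [h0 y hy]
      rfl
    rw [extD_congr h2]
    exact congrFun (extDLinear (M := M)).map_zero x
  rw [integral_of_support hK hKq hs h1]
  have hU := (chartAt ℂ q).open_target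
  obtain ⟨hc1, hc2⟩ := isCompact_image_chart hK hKq
  have hv : ∀ v : ℂ, ContDiff ℝ ∞ ((chartAt ℂ q).target.indicator
      fun z => chartForm q (fun x => α x) z v) ∧ HasCompactSupport
        ((chartAt ℂ q).target.indicator fun z => chartForm q (fun x => α x) z v) := fun v => by
    refine contDiff_indicator hU hc1 hc2 (fun z hz hzK => ?_) fun z hz => ?_
    · rw [chartForm, h0 _ (symm_notMem_of_notMem_image hz hzK)]
      rfl
    · exact ((contDiffAt_chartForm hz (α.smoothFormAt _)).clm_apply
        contDiffAt_const).contDiffWithinAt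
  set g : ℂ → ℂ → ℂ := fun v => (chartAt ℂ q).target.indicator
    fun z => chartForm q (fun x => α x) z v with hg
  have hgd : ∀ v w z : ℂ, z ∈ (chartAt ℂ q).target →
      fderiv ℝ (g v) z w = fderiv ℝ (chartForm q fun x => α x) z w v := fun v w z hz => by
    have h2 : g v =ᶠ[𝓝 z] fun z => chartForm q (fun x => α x) z v := by
      filter_upwards [hU.mem_nhds hz] with y hy
      exact indicator_of_mem hy _
    have h3 : HasFDerivAt (fun z => chartForm q (fun x => α x) z v) _ z :=
      ((ContinuousLinearMap.apply ℝ ℂ v).hasFDerivAt).comp z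
        ((contDiffAt_chartForm hz (α.smoothFormAt _)).differentiableAt (by simp)).hasFDerivAt
    rw [h2.fderiv_eq, h3.fderiv]
    rfl
  -- The derivatives of the extensions vanish off the chart target, including at its boundary, so
  -- the integral over the target is one over the whole plane.
  have h5 : ∀ v w z : ℂ, z ∉ (chartAt ℂ q).target → fderiv ℝ (g v) z w = 0 := fun v w z hz => by
    have h2 : g v =ᶠ[𝓝 z] fun _ => 0 := by
      filter_upwards [hc1.isClosed.isOpen_compl.mem_nhds fun h => hz (hc2 h)] with y hy
      by_cases hyU : y ∈ (chartAt ℂ q).target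
      · rw [hg]
        simp only [indicator_of_mem hyU]
        rw [chartForm, h0 _ (symm_notMem_of_notMem_image hyU hy)]
        rfl
      · exact indicator_of_notMem hyU _
    rw [h2.fderiv_eq]
    simp
  have h6 : ∀ v w : ℂ, Integrable fun z => fderiv ℝ (g v) z w := fun v w =>
    (((hv v).1.continuous_fderiv (by simp)).clm_apply
      continuous_const).integrable_of_hasCompactSupport ((hv v).2.fderiv_apply (𝕜 := ℝ) w)
  have h7 : ∫ z in (chartAt ℂ q).target, density q (extD fun x => α x) z =
      ∫ z in (chartAt ℂ q).target,
        (fderiv ℝ (g Complex.I) z 1 - fderiv ℝ (g 1) z Complex.I) := by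
    refine setIntegral_congr_fun hU.measurableSet fun z hz => ?_
    simp only [hgd _ _ _ hz]
    exact density_extD hz (α.smoothFormAt _)
  rw [h7, setIntegral_eq_integral_of_forall_compl_eq_zero fun z hz => by
      rw [h5 _ _ _ hz, h5 _ _ _ hz, sub_zero],
    MeasureTheory.integral_sub (h6 _ _) (h6 _ _), integral_fderiv_eq_zero (hv _).1 (hv _).2,
    integral_fderiv_eq_zero (hv _).1 (hv _).2, sub_zero]

/-- Stokes' theorem on a closed Riemann surface. -/
theorem integral_extD (α : OneForm M) : integral (extD fun x => α x) = 0 := by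
  -- `α = ∑ ρ_p α`, a finite sum by compactness, each summand supported in a single chart.
  have h1 : α = ∑ p ∈ partitionIndex M, smulForm (contMDiff_chartPartition p) α := by
    ext1 x
    have h2 : (∑ p ∈ partitionIndex M, smulForm (contMDiff_chartPartition p) α) x =
        ∑ p ∈ partitionIndex M, ((chartPartition M p x : ℝ) : ℂ) • α x := by
      refine (congrFun (map_sum (ContMDiffSection.coeAddHom 𝓘(ℝ, ℂ) (ℂ →L[ℝ] ℂ) ∞
        (fun x : M => TangentSpace 𝓘(ℝ, ℂ) x →L[ℝ] ℂ)) _ _) x).trans ?_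
      rw [Finset.sum_apply]
      rfl
    rw [h2, ← Finset.sum_smul, ← Complex.ofReal_sum, sum_chartPartition]
    simp
  have h3 : extD (fun x => α x) = fun x => ∑ p ∈ partitionIndex M,
      extD (fun y => smulForm (contMDiff_chartPartition p) α y) x := by
    have h4 := congrArg extDLinear h1
    rw [map_sum] at h4
    refine h4.trans ?_
    funext x
    rw [Finset.sum_apply]
    rfl
  rw [h3, (integral_sum _ _ fun p _ => isSmooth_extD (OneForm.smoothFormAt _)).2]
  refine Finset.sum_eq_zero fun p _ => integral_extD_of_support (isClosed_tsupport _)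
    (tsupport_chartPartition_subset p) _ fun x hx => ?_
  change ((chartPartition M p x : ℝ) : ℂ) • α x = 0
  rw [image_eq_zero_of_notMem_tsupport hx, Complex.ofReal_zero]
  exact zero_smul ℂ (α x : ℂ →L[ℝ] ℂ)

end Integration

/-! ### Connection forms and curvature -/

section Curvature

variable {M : Type*} [TopologicalSpace M] [ChartedSpace ℂ M] [IsManifold 𝓘(ℝ, ℂ) ∞ M]
  {L : M → Type*} [TopologicalSpace (TotalSpace ℂ L)] [∀ x, NormedAddCommGroup (L x)]
  [∀ x, InnerProductSpace ℂ (L x)] [FiberBundle ℂ L] [VectorBundle ℂ ℂ L]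
  [ContMDiffVectorBundle ∞ ℂ L 𝓘(ℝ, ℂ)]

theorem eq_smul_localFrame {x₀ y : M} (hy : y ∈ (trivializationAt ℂ L x₀).baseSet) (s : L y) :
    s = (trivializationAt ℂ L x₀ ⟨y, s⟩).2 • localFrame (L := L) x₀ y := by
  have h1 := ((trivializationAt ℂ L x₀).symmₗ ℂ y).map_smul (trivializationAt ℂ L x₀ ⟨y, s⟩).2 1
  rw [smul_eq_mul, mul_one, Trivialization.coe_symmₗ (hb := hy)] at h1
  rw [localFrame, ← h1]
  exact ((trivializationAt ℂ L x₀).symm_apply_apply_mk hy s).symm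

theorem coord_localFrame {x₀ y : M} (hy : y ∈ (trivializationAt ℂ L x₀).baseSet) :
    (trivializationAt ℂ L x₀ ⟨y, localFrame (L := L) x₀ y⟩).2 = 1 := by
  rw [localFrame, (trivializationAt ℂ L x₀).apply_mk_symm hy]

theorem localFrame_ne_zero {x₀ y : M} (hy : y ∈ (trivializationAt ℂ L x₀).baseSet) :
    localFrame (L := L) x₀ y ≠ 0 := by
  intro h
  have h1 := coord_localFrame hy
  rw [h] at h1
  have h2 := ((trivializationAt ℂ L x₀).linear ℂ hy).map_zero
  exact zero_ne_one (h2.symm.trans h1)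

theorem coord_smul {x₀ y : M} (hy : y ∈ (trivializationAt ℂ L x₀).baseSet) (c : ℂ) (s : L y) :
    (trivializationAt ℂ L x₀ ⟨y, c • s⟩).2 = c * (trivializationAt ℂ L x₀ ⟨y, s⟩).2 :=
  ((trivializationAt ℂ L x₀).linear ℂ hy).2 c s

theorem contMDiffOn_localFrame (x₀ : M) :
    ContMDiffOn 𝓘(ℝ, ℂ) (𝓘(ℝ, ℂ).prod 𝓘(ℝ, ℂ)) ∞
      (fun x => TotalSpace.mk' ℂ x (localFrame (L := L) x₀ x))
      (trivializationAt ℂ L x₀).baseSet := by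
  intro y hy
  refine ContMDiffAt.contMDiffWithinAt ?_
  rw [(trivializationAt ℂ L x₀).contMDiffAt_section_iff hy]
  refine (contMDiffAt_const (c := (1 : ℂ))).congr_of_eventuallyEq ?_
  filter_upwards [(trivializationAt ℂ L x₀).open_baseSet.mem_nhds hy] with z hz
  exact coord_localFrame hz

theorem contMDiffAt_localFrame {x₀ y : M} (hy : y ∈ (trivializationAt ℂ L x₀).baseSet) :
    ContMDiffAt 𝓘(ℝ, ℂ) (𝓘(ℝ, ℂ).prod 𝓘(ℝ, ℂ)) ∞
      (fun x => TotalSpace.mk' ℂ x (localFrame (L := L) x₀ x)) y :=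
  (contMDiffOn_localFrame x₀ y hy).contMDiffAt
    ((trivializationAt ℂ L x₀).open_baseSet.mem_nhds hy)

theorem secDiffAt_localFrame {x₀ y : M} (hy : y ∈ (trivializationAt ℂ L x₀).baseSet) :
    SecDiffAt L (localFrame x₀) y :=
  (contMDiffAt_localFrame hy).mdifferentiableAt (by simp)

/-- The Leibniz rule for complex valued functions. -/
theorem UnitaryConnection.leibniz_complex (A : UnitaryConnection L) {f : M → ℂ} {σ : ∀ x, L x}
    {x : M} (hf : MDifferentiableAt 𝓘(ℝ, ℂ) 𝓘(ℝ, ℂ) f x) (hσ : SecDiffAt L σ x)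
    (v : TangentSpace 𝓘(ℝ, ℂ) x) :
    SecDiffAt L (fun y => f y • σ y) x ∧
    A.toFun (fun y => f y • σ y) x v = f x • A.toFun σ x v + mvfderiv 𝓘(ℝ, ℂ) f x v • σ x := by
  have hre : HasMFDerivAt 𝓘(ℝ, ℂ) 𝓘(ℝ, ℝ) (fun y => (f y).re) x _ :=
    (Complex.reCLM.hasMFDerivAt (x := f x)).comp x hf.hasMFDerivAt
  have him : HasMFDerivAt 𝓘(ℝ, ℂ) 𝓘(ℝ, ℝ) (fun y => (f y).im) x _ :=
    (Complex.imCLM.hasMFDerivAt (x := f x)).comp x hf.hasMFDerivAt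
  have hre' : mvfderiv 𝓘(ℝ, ℂ) (fun y => (f y).re) x v = (mvfderiv 𝓘(ℝ, ℂ) f x v).re :=
    congrArg (fun T => T v) hre.mfderiv
  have him' : mvfderiv 𝓘(ℝ, ℂ) (fun y => (f y).im) x v = (mvfderiv 𝓘(ℝ, ℂ) f x v).im :=
    congrArg (fun T => T v) him.mfderiv
  -- The Leibniz rule of a covariant derivative is for real functions; complex ones are reached by
  -- splitting `f = Re f + i Im f` and commuting `∇` with `i`.
  have hsplit : (fun y => f y • σ y) = ((fun y => (f y).re) • σ +
      (fun y => (f y).im) • fun y => Complex.I • σ y : ∀ x, L x) := by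
    funext y
    change f y • σ y = (f y).re • σ y + (f y).im • Complex.I • σ y
    rw [← Complex.coe_smul, ← Complex.coe_smul, smul_smul, ← add_smul, Complex.re_add_im]
  have h1 := SecDiffAt.smul hre.mdifferentiableAt hσ
  have h2 := SecDiffAt.smul him.mdifferentiableAt (hσ.const_smul Complex.I)
  rw [hsplit]
  refine ⟨h1.add h2, ?_⟩
  rw [A.isCovariantDerivativeOnUniv.add h1 h2,
    A.isCovariantDerivativeOnUniv.leibniz hσ hre.mdifferentiableAt,
    A.isCovariantDerivativeOnUniv.leibniz (hσ.const_smul Complex.I) him.mdifferentiableAt]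
  change ((f x).re • A.toFun σ x v + mvfderiv 𝓘(ℝ, ℂ) (fun y => (f y).re) x v • σ x) +
    ((f x).im • A.toFun (fun y => Complex.I • σ y) x v +
      mvfderiv 𝓘(ℝ, ℂ) (fun y => (f y).im) x v • Complex.I • σ x) = _
  rw [A.map_I_smul σ x hσ v, hre', him']
  conv_rhs => rw [← Complex.re_add_im (f x), ← Complex.re_add_im (mvfderiv 𝓘(ℝ, ℂ) f x v)]
  simp only [← Complex.coe_smul, smul_smul, add_smul]
  abel

theorem UnitaryConnection.localForm_apply (A : UnitaryConnection L) {x₀ y : M}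
    (hy : y ∈ (trivializationAt ℂ L x₀).baseSet) (v : TangentSpace 𝓘(ℝ, ℂ) y) :
    A.localForm x₀ y v = (trivializationAt ℂ L x₀ ⟨y, A.toFun (localFrame x₀) y v⟩).2 := by
  rw [localForm, ContinuousLinearMap.comp_apply, Trivialization.continuousLinearMapAt_apply,
    Trivialization.coe_linearMapAt_of_mem _ hy]

theorem UnitaryConnection.apply_localFrame (A : UnitaryConnection L) {x₀ y : M}
    (hy : y ∈ (trivializationAt ℂ L x₀).baseSet) (v : TangentSpace 𝓘(ℝ, ℂ) y) :
    A.toFun (localFrame x₀) y v = A.localForm x₀ y v • localFrame x₀ y := by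
  rw [A.localForm_apply hy]
  exact eq_smul_localFrame hy _

theorem UnitaryConnection.localForm_eq_of_apply (A : UnitaryConnection L) {x₀ y : M}
    (hy : y ∈ (trivializationAt ℂ L x₀).baseSet) {v : TangentSpace 𝓘(ℝ, ℂ) y} {c : ℂ}
    (h : A.toFun (localFrame x₀) y v = c • localFrame x₀ y) : A.localForm x₀ y v = c := by
  rw [A.localForm_apply hy, h, coord_smul hy, coord_localFrame hy, mul_one]

/-- In the bundle coordinates at `x₀`, the smooth section `∇e` of the Hom bundle is the connection
form itself. Other points of the frame's domain follow in `smooth_localForm` from the change of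
frame. -/
theorem UnitaryConnection.smoothFormAt_localForm_self (A : UnitaryConnection L) (x₀ : M) :
    SmoothFormAt (A.localForm x₀) x₀ := by
  refine smoothFormAt_of_contMDiffAt (contMDiffAt_oneForm_iff.2 ?_)
  have hx := mem_baseSet_trivializationAt ℂ L x₀
  have hU := (trivializationAt ℂ L x₀).open_baseSet
  have h1 := (A.smooth _ hU).contMDiff (contMDiffOn_localFrame x₀)
  have h2 := (h1 x₀ hx).contMDiffAt (hU.mem_nhds hx)
  rw [contMDiffAt_hom_bundle] at h2
  exact h2.2

/-- The change of the connection form under a change of frame. -/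
theorem UnitaryConnection.localForm_change (A : UnitaryConnection L) (x₀ x₁ : M) :
    ∃ g : M → ℂ, ∀ y ∈ (trivializationAt ℂ L x₀).baseSet, y ∈ (trivializationAt ℂ L x₁).baseSet →
      ContMDiffAt 𝓘(ℝ, ℂ) 𝓘(ℝ, ℂ) ∞ g y ∧ g y ≠ 0 ∧
      A.localForm x₀ y = A.localForm x₁ y + (g y)⁻¹ • mvfderiv 𝓘(ℝ, ℂ) g y := by
  refine ⟨fun y => (trivializationAt ℂ L x₁ ⟨y, localFrame (L := L) x₀ y⟩).2,
    fun y hy₀ hy₁ => ?_⟩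
  set g := fun y => (trivializationAt ℂ L x₁ ⟨y, localFrame (L := L) x₀ y⟩).2 with hg
  have hrel : ∀ z ∈ (trivializationAt ℂ L x₁).baseSet,
      localFrame (L := L) x₀ z = g z • localFrame x₁ z := fun z hz => eq_smul_localFrame hz _
  have hgs : ContMDiffAt 𝓘(ℝ, ℂ) 𝓘(ℝ, ℂ) ∞ g y :=
    ((trivializationAt ℂ L x₁).contMDiffAt_section_iff hy₁).1 (contMDiffAt_localFrame hy₀)
  have hg0 : g y ≠ 0 := fun h => localFrame_ne_zero (L := L) hy₀ (by rw [hrel y hy₁, h, zero_smul])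
  refine ⟨hgs, hg0, ?_⟩
  ext v
  refine A.localForm_eq_of_apply hy₀ ?_
  have h1 := A.leibniz_complex (hgs.mdifferentiableAt (by simp)) (secDiffAt_localFrame hy₁) v
  -- With `e₀ = g e₁` near `y`, locality of `∇` gives `∇e₀ = dg e₁ + g θ₁ e₁ = (θ₁ + g⁻¹ dg) e₀`.
  have h2 : A.toFun (localFrame x₀) y = A.toFun (fun z => g z • localFrame x₁ z) y := by
    refine A.isCovariantDerivativeOnUniv.congr_of_eventuallyEq (secDiffAt_localFrame hy₀) h1.1
      univ_mem ?_
    filter_upwards [(trivializationAt ℂ L x₁).open_baseSet.mem_nhds hy₁] with z hz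
    exact hrel z hz
  rw [h2, h1.2, A.apply_localFrame hy₁, hrel y hy₁, smul_smul, smul_smul, ← add_smul]
  congr 1
  change _ = (A.localForm x₁ y v + (g y)⁻¹ * mvfderiv 𝓘(ℝ, ℂ) g y v) * g y
  field_simp

/-- The definition of `curvature` uses a different frame at every point. Two connection forms differ
by the closed form `g⁻¹ dg`, so one frame computes the curvature on its whole domain; smoothness of
the curvature rests on this. -/
theorem UnitaryConnection.smooth_localForm (A : UnitaryConnection L) {x₀ y : M}
    (hy : y ∈ (trivializationAt ℂ L x₀).baseSet) :
    SmoothFormAt (A.localForm x₀) y ∧ extD (A.localForm x₀) y = A.curvature y := by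
  obtain ⟨g, hg⟩ := A.localForm_change x₀ y
  have hy' := mem_baseSet_trivializationAt ℂ L y
  have hev : ∀ᶠ z in 𝓝 y, ContMDiffAt 𝓘(ℝ, ℂ) 𝓘(ℝ, ℂ) ∞ g z ∧ g z ≠ 0 ∧
      A.localForm x₀ z = A.localForm y z + (g z)⁻¹ • mvfderiv 𝓘(ℝ, ℂ) g z := by
    filter_upwards [(trivializationAt ℂ L x₀).open_baseSet.mem_nhds hy,
      (trivializationAt ℂ L y).open_baseSet.mem_nhds hy'] with z hz hz'
    exact hg z hz hz'
  obtain ⟨h1, h2⟩ := extD_inv_smul_mvfderiv (hev.mono fun z hz => hz.1) hev.self_of_nhds.2.1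
  have h3 := A.smoothFormAt_localForm_self y
  have h4 := hev.mono fun z hz => hz.2.2
  refine ⟨(h3.add h1).congr h4, ?_⟩
  rw [extD_congr h4, extD_add h3 h1, h2, add_zero]
  rfl

theorem UnitaryConnection.isSmooth_curvature (A : UnitaryConnection L) :
    TwoForm.IsSmooth A.curvature := by
  intro p z hz
  set x := (chartAt ℂ p).symm z with hx
  have hxb := mem_baseSet_trivializationAt ℂ L x
  refine ContDiffAt.contDiffWithinAt ?_
  refine (contDiffAt_curl (contDiffAt_chartForm hz
    (A.smooth_localForm hxb).1)).congr_of_eventuallyEq ?_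
  filter_upwards [(chartAt ℂ p).open_target.mem_nhds hz,
    ((chartAt ℂ p).continuousAt_symm hz).eventually
      ((trivializationAt ℂ L x).open_baseSet.mem_nhds hxb)] with y hy hyb
  obtain ⟨h1, h2⟩ := A.smooth_localForm (show (chartAt ℂ p).symm y ∈ _ from hyb)
  rw [← density_extD hy h1]
  simp only [density, h2]

theorem UnitaryConnection.addForm_apply (A : UnitaryConnection L) (α : ImOneForm M)
    {σ : ∀ x, L x} {x : M} (hσ : SecDiffAt L σ x) (v : TangentSpace 𝓘(ℝ, ℂ) x) :
    (A.addForm α).toFun σ x v = A.toFun σ x v + (α : OneForm M) x v • σ x := by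
  simp only [addForm, hσ, if_true]
  rfl

/-- The curvature of `A + α` is `F_A + dα`. -/
theorem UnitaryConnection.curvature_addForm (A : UnitaryConnection L) (α : ImOneForm M) (x : M) :
    (A.addForm α).curvature x = A.curvature x + extD (fun y => (α : OneForm M) y) x := by
  have hx := mem_baseSet_trivializationAt ℂ L x
  have h1 : ∀ᶠ y in 𝓝 x, (A.addForm α).localForm x y = A.localForm x y + (α : OneForm M) y := by
    filter_upwards [(trivializationAt ℂ L x).open_baseSet.mem_nhds hx] with y hy
    ext v
    refine (A.addForm α).localForm_eq_of_apply hy ?_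
    rw [A.addForm_apply α (secDiffAt_localFrame hy), A.apply_localFrame hy, ← add_smul]
    rfl
  rw [curvature, extD_congr h1,
    extD_add (A.smoothFormAt_localForm_self x) (OneForm.smoothFormAt _ x)]
  rfl

theorem alternating_re_eq_zero {η : ℂ [⋀^Fin 2]→L[ℝ] ℂ} (h : (η ![1, Complex.I]).re = 0)
    (v : Fin 2 → ℂ) : (η v).re = 0 := by
  let T : ℂ →L[ℝ] ℂ := Complex.reCLM.smulRight (v 0) + Complex.imCLM.smulRight (v 1)
  have hv : v = ![T 1, T Complex.I] := by
    funext i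
    fin_cases i <;> simp [T]
  rw [hv, alternating_apply, Complex.re_ofReal_mul, h, mul_zero]

theorem curl_conj {θ : ℂ → ℂ →L[ℝ] ℂ} {z : ℂ} (h : DifferentiableAt ℝ θ z) :
    DifferentiableAt ℝ (fun y => (Complex.conjCLE : ℂ →L[ℝ] ℂ).comp (θ y)) z ∧
    curl (fun y => (Complex.conjCLE : ℂ →L[ℝ] ℂ).comp (θ y)) z =
      (starRingEnd ℂ) (curl θ z) := by
  have h1 : HasFDerivAt (fun y => (Complex.conjCLE : ℂ →L[ℝ] ℂ).comp (θ y)) _ z :=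
    ((ContinuousLinearMap.compL ℝ ℂ ℂ ℂ (Complex.conjCLE : ℂ →L[ℝ] ℂ)).hasFDerivAt).comp z
      h.hasFDerivAt
  refine ⟨h1.differentiableAt, ?_⟩
  rw [curl, h1.fderiv, curl, map_sub]
  rfl

/-- The curvature of a unitary connection is purely imaginary. -/
theorem UnitaryConnection.curvature_re [IsSmoothHermitian L] (A : UnitaryConnection L) (x : M)
    (v : Fin 2 → TangentSpace 𝓘(ℝ, ℂ) x) : (A.curvature x v).re = 0 := by
  have hx := mem_baseSet_trivializationAt ℂ L x
  have hU := (trivializationAt ℂ L x).open_baseSet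
  set h : M → ℂ := fun y => inner ℂ (localFrame (L := L) x y) (localFrame x y) with hh
  have hs : ∀ᶠ y in 𝓝 x, ContMDiffAt 𝓘(ℝ, ℂ) 𝓘(ℝ, ℂ) ∞ h y := by
    filter_upwards [hU.mem_nhds hx] with y hy
    exact (IsSmoothHermitian.smooth_inner _ hU _ _ (contMDiffOn_localFrame x)
      (contMDiffOn_localFrame x) y hy).contMDiffAt (hU.mem_nhds hy)
  have h0 : ∀ y ∈ (trivializationAt ℂ L x).baseSet, h y ≠ 0 := fun y hy =>
    inner_self_ne_zero.2 (localFrame_ne_zero hy)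
  obtain ⟨h1, h2⟩ := extD_inv_smul_mvfderiv hs (h0 x hx)
  -- Metric compatibility applied to the pair `(e, e)` reads `dh = (θ + θ̄) h`, with `h = |e|²`.
  have h3 : ∀ y ∈ (trivializationAt ℂ L x).baseSet, ∀ v, (h y)⁻¹ * mvfderiv 𝓘(ℝ, ℂ) h y v =
      A.localForm x y v + (starRingEnd ℂ) (A.localForm x y v) := fun y hy v => by
    have h4 := A.metric _ _ y (secDiffAt_localFrame hy) (secDiffAt_localFrame hy) v
    rw [A.apply_localFrame hy, inner_smul_left, inner_smul_right] at h4
    have h5 : mvfderiv 𝓘(ℝ, ℂ) h y v = ((starRingEnd ℂ) (A.localForm x y v)) * h y +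
      A.localForm x y v * h y := h4
    rw [h5]
    field_simp [h0 y hy]
    ring
  have hθ := A.smoothFormAt_localForm_self x
  have hθd := ContDiffAt.differentiableAt hθ (by simp)
  have h4 : chartForm x (fun y => (h y)⁻¹ • mvfderiv 𝓘(ℝ, ℂ) h y) =ᶠ[𝓝 (chartAt ℂ x x)]
      fun z => chartForm x (A.localForm x) z +
        (Complex.conjCLE : ℂ →L[ℝ] ℂ).comp (chartForm x (A.localForm x) z) := by
    have ht : Tendsto (chartAt ℂ x).symm (𝓝 (chartAt ℂ x x)) (𝓝 x) := by
      have := (chartAt ℂ x).symm.continuousAt (mem_chart_target ℂ x)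
      rwa [ContinuousAt, (chartAt ℂ x).left_inv (mem_chart_source ℂ x)] at this
    filter_upwards [ht.eventually (hU.mem_nhds hx)] with z hz
    ext1 v
    exact h3 _ hz _
  have h5 := density_extD_self h1
  have h6 : density x (extD fun y => (h y)⁻¹ • mvfderiv 𝓘(ℝ, ℂ) h y) (chartAt ℂ x x) = 0 := by
    rw [density_self, h2]
    rfl
  obtain ⟨h7, h8⟩ := curl_conj hθd
  -- Taking `d` of `θ + θ̄ = h⁻¹ dh` gives `0 = 2 Re` of the density of `dθ` at `x`.
  rw [h6, curl_congr h4, curl_add hθd h7, h8, Complex.add_conj, ← density_extD_self hθ] at h5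
  refine alternating_re_eq_zero (η := A.curvature x) ?_ v
  have h9 : ((A.curvature x : ℂ [⋀^Fin 2]→L[ℝ] ℂ) ![(1 : ℂ), Complex.I]) =
      density x (extD (A.localForm x)) (chartAt ℂ x x) := by
    rw [density_self]
    rfl
  refine (congrArg Complex.re h9).trans ?_
  have h10 := Complex.ofReal_eq_zero.1 h5.symm
  linarith

end Curvature

/-! ### The moment map -/

section MomentMap

variable {M : Type*} [TopologicalSpace M] [ChartedSpace ℂ M] [IsManifold 𝓘(ℝ, ℂ) ∞ M]
  {L : M → Type*} [TopologicalSpace (TotalSpace ℂ L)] [∀ x, NormedAddCommGroup (L x)]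
  [∀ x, InnerProductSpace ℂ (L x)] [FiberBundle ℂ L] [VectorBundle ℂ ℂ L]
  [ContMDiffVectorBundle ∞ ℂ L 𝓘(ℝ, ℂ)]

theorem imFun_eq_im_mul_I (ζ : ImFun M) (x : M) :
    (ζ : C^∞⟮𝓘(ℝ, ℂ), M; 𝓘(ℝ, ℂ), ℂ⟯) x =
      (((ζ : C^∞⟮𝓘(ℝ, ℂ), M; 𝓘(ℝ, ℂ), ℂ⟯) x).im : ℂ) * Complex.I := by
  conv_lhs => rw [← Complex.re_add_im ((ζ : C^∞⟮𝓘(ℝ, ℂ), M; 𝓘(ℝ, ℂ), ℂ⟯) x), ζ.2 x]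
  simp

theorem expGauge_coe (t : ℝ) (ζ : ImFun M) (x : M) :
    ((expGauge (t • ζ)) x : ℂ) =
      Complex.exp ((t : ℂ) * (ζ : C^∞⟮𝓘(ℝ, ℂ), M; 𝓘(ℝ, ℂ), ℂ⟯) x) := by
  have h1 : ((expGauge (t • ζ)) x : ℂ) =
      Complex.exp (((t • (ζ : C^∞⟮𝓘(ℝ, ℂ), M; 𝓘(ℝ, ℂ), ℂ⟯) x).im : ℂ) * Complex.I) :=
    Circle.coe_exp _
  rw [h1]
  conv_rhs => rw [imFun_eq_im_mul_I ζ x]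
  simp [mul_assoc]

/-- By the chain rule `e^{-tζ} d(e^{tζ}) = t dζ`, so the connection component of the gauge orbit is
an affine function of `t`. -/
theorem logD_expGauge (t : ℝ) (ζ : ImFun M) (x : M) (v : TangentSpace 𝓘(ℝ, ℂ) x) :
    (logD (expGauge (t • ζ)) : OneForm M) x v = t * (dIm ζ : OneForm M) x v := by
  set f : M → ℂ := fun y => (ζ : C^∞⟮𝓘(ℝ, ℂ), M; 𝓘(ℝ, ℂ), ℂ⟯) y with hf
  have hd : HasMFDerivAt 𝓘(ℝ, ℂ) 𝓘(ℝ, ℂ) f x _ :=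
    (ζ.1.contMDiff.mdifferentiableAt (by simp)).hasMFDerivAt
  have h1 : HasDerivAt (fun w : ℂ => Complex.exp ((t : ℂ) * w))
      (Complex.exp ((t : ℂ) * f x) * t) (f x) := by
    simpa using ((hasDerivAt_id (f x)).const_mul (t : ℂ)).cexp
  have h2 : HasMFDerivAt 𝓘(ℝ, ℂ) 𝓘(ℝ, ℂ) (fun y => Complex.exp ((t : ℂ) * f y)) x _ :=
    (h1.hasFDerivAt.restrictScalars ℝ).hasMFDerivAt.comp x hd
  have h3 : mvfderiv 𝓘(ℝ, ℂ) (fun y => Complex.exp ((t : ℂ) * f y)) x v =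
      mvfderiv 𝓘(ℝ, ℂ) f x v * (Complex.exp ((t : ℂ) * f x) * t) :=
    congrArg (fun T => T v) h2.mfderiv
  change ((expGauge (t • ζ)) x : ℂ)⁻¹ *
    mvfderiv 𝓘(ℝ, ℂ) (fun y => ((expGauge (t • ζ)) y : ℂ)) x v = t * mvfderiv 𝓘(ℝ, ℂ) f x v
  simp only [expGauge_coe]
  change (Complex.exp ((t : ℂ) * f x))⁻¹ *
    mvfderiv 𝓘(ℝ, ℂ) (fun y => Complex.exp ((t : ℂ) * f y)) x v = _
  rw [h3]
  field_simp [Complex.exp_ne_zero]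

theorem hasDerivAt_expGauge_smul (ζ : ImFun M) (s : Sec L) (x : M) :
    HasDerivAt (fun t : ℝ => (smulSec (gaugeFun (expGauge (t • ζ))⁻¹) s) x)
      ((-smulSec (ζ : C^∞⟮𝓘(ℝ, ℂ), M; 𝓘(ℝ, ℂ), ℂ⟯) s) x) 0 := by
  set c := (ζ : C^∞⟮𝓘(ℝ, ℂ), M; 𝓘(ℝ, ℂ), ℂ⟯) x with hc
  have h1 : (fun t : ℝ => (smulSec (gaugeFun (expGauge (t • ζ))⁻¹) s) x) =
      fun t : ℝ => Complex.exp (-((t : ℂ) * c)) • s x := by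
    funext t
    have h2 : (gaugeFun (expGauge (t • ζ))⁻¹) x = ((expGauge (t • ζ)) x : ℂ)⁻¹ :=
      Circle.coe_inv _
    change (gaugeFun (expGauge (t • ζ))⁻¹) x • s x = _
    rw [h2, expGauge_coe, Complex.exp_neg]
  have h3 : HasDerivAt (fun t : ℝ => Complex.exp (-((t : ℂ) * c))) (-c) 0 := by
    simpa using (((Complex.ofRealCLM.hasDerivAt (x := 0)).mul_const c).neg).cexp
  have h4 := h3.smul_const (s x)
  rw [h1]
  rw [neg_smul] at h4
  exact h4

theorem hasVelocity_gaugeAct (ζ : ImFun M) (p : Config L) :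
    HasVelocity (fun t : ℝ => gaugeAct (expGauge (t • ζ)) p) (infGauge ζ p) where
  connection σ x hσ v := by
    have h1 : (fun t : ℝ => (gaugeAct (expGauge (t • ζ)) p).A.toFun σ x v) =
        fun t : ℝ => p.A.toFun σ x v + t • (dIm ζ : OneForm M) x v • σ x := by
      funext t
      refine (p.A.addForm_apply _ hσ v).trans ?_
      rw [logD_expGauge, mul_smul, Complex.coe_smul]
    rw [h1]
    have h2 := ((hasDerivAt_id (0 : ℝ)).smul_const ((dIm ζ : OneForm M) x v • σ x)).const_add
      (p.A.toFun σ x v)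
    rw [one_smul] at h2
    exact h2
  spinor₁ x := hasDerivAt_expGauge_smul ζ _ x
  spinor₂ x := hasDerivAt_expGauge_smul ζ _ x
  higgs x v := hasDerivAt_const (0 : ℝ) ((p.Φ : OneForm M) x v)

/-- Each term is invariant separately: the curvature changes by `d(u⁻¹ du) = 0`, and multiplication
by a number of modulus one preserves the fibre norms. -/
theorem momentMap_gaugeAct (w : TwoForm M) (u : GaugeGroup M) (p : Config L) :
    momentMap w (gaugeAct u p) = momentMap w p := by
  funext x
  have h1 : (gaugeAct u p).A.curvature x = p.A.curvature x := by
    refine (p.A.curvature_addForm (logD u) x).trans ?_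
    rw [show extD (fun y => (logD u : OneForm M) y) x = 0 from (extD_inv_smul_mvfderiv
      (.of_forall fun y => contMDiff_gauge_coe u y) (Circle.coe_ne_zero _)).2, add_zero]
  have h2 : ∀ s : Sec L, ‖(smulSec (gaugeFun u⁻¹) s) x‖ = ‖s x‖ := fun s => by
    change ‖(gaugeFun u⁻¹) x • s x‖ = ‖s x‖
    rw [norm_smul, show ‖(gaugeFun u⁻¹) x‖ = 1 from Circle.norm_coe _, one_mul]
  have h3 : spinorNormSq (gaugeAct u p) x = spinorNormSq p x := by
    simp only [spinorNormSq, gaugeAct, h2]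
  rw [momentMap, momentMap, h1, h3]

/-- The pairing `Re ⟨ψ, β⟩` of two sections of `L ⊕ L`. -/
def rePair (Ψ β : Sec L × Sec L) (x : M) : ℝ := (hermPair Ψ β x).re

theorem contMDiff_hermPair [IsSmoothHermitian L] (Ψ β : Sec L × Sec L) :
    ContMDiff 𝓘(ℝ, ℂ) 𝓘(ℝ, ℂ) ∞ (hermPair Ψ β) := by
  have h : ∀ s t : Sec L, ContMDiff 𝓘(ℝ, ℂ) 𝓘(ℝ, ℂ) ∞ (fun x => inner ℂ (s x) (t x)) :=
    fun s t => contMDiffOn_univ.1 (IsSmoothHermitian.smooth_inner univ isOpen_univ _ _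
      s.contMDiff.contMDiffOn t.contMDiff.contMDiffOn)
  exact (h _ _).add (h _ _)

theorem contMDiff_rePair [IsSmoothHermitian L] (c : ℂ) (Ψ β : Sec L × Sec L) :
    ContMDiff 𝓘(ℝ, ℂ) 𝓘(ℝ, ℂ) ∞ (fun x => c * (rePair Ψ β x : ℂ)) := by
  have h : ContDiff ℝ ∞ (fun z : ℂ => c * (z.re : ℂ)) :=
    contDiff_const.mul (Complex.ofRealCLM.contDiff.comp Complex.reCLM.contDiff)
  exact h.contMDiff.comp (contMDiff_hermPair Ψ β)

theorem rePair_self (Ψ : Sec L × Sec L) (x : M) :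
    rePair Ψ Ψ x = ‖Ψ.1 x‖ ^ 2 + ‖Ψ.2 x‖ ^ 2 := by
  rw [rePair, hermPair, inner_self_eq_norm_sq_to_K, inner_self_eq_norm_sq_to_K]
  norm_cast

theorem momentMap_eq (w : TwoForm M) (p : Config L) :
    momentMap w p = fun x => p.A.curvature x - (Complex.I / 2 * (rePair p.Ψ p.Ψ x : ℂ)) • w x := by
  funext x
  rw [momentMap, spinorNormSq, rePair_self]
  congr 2
  push_cast
  ring

theorem isSmooth_momentMap [IsSmoothHermitian L] {w : TwoForm M} (hw : w.IsSmooth)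
    (p : Config L) : (momentMap w p).IsSmooth := by
  rw [momentMap_eq]
  exact p.A.isSmooth_curvature.sub (hw.smul (contMDiff_rePair _ _ _))

theorem IsAreaForm.im_eq_zero {w : TwoForm M} (hw : IsAreaForm w) (x : M)
    (v : Fin 2 → TangentSpace 𝓘(ℝ, ℂ) x) : (w x v).im = 0 := by
  obtain ⟨r, _, h⟩ := hw.pos x _ (mem_chart_target ℂ x)
  rw [density_self] at h
  -- Positivity controls `w` only on the pair `(1, i)`. Multiplying by `i` turns "real" into
  -- "imaginary", and the lemma on vanishing real parts extends this to all pairs.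
  have h1 := alternating_re_eq_zero
    (η := (Complex.I • (w x : ℂ [⋀^Fin 2]→L[ℝ] ℂ) : ℂ [⋀^Fin 2]→L[ℝ] ℂ)) (by
      change (Complex.I * (w x : ℂ [⋀^Fin 2]→L[ℝ] ℂ) ![(1 : ℂ), Complex.I]).re = 0
      rw [h]
      simp) v
  have h2 : (Complex.I * w x v).re = 0 := h1
  simpa using h2

theorem momentMap_re [IsSmoothHermitian L] {w : TwoForm M} (hw : IsAreaForm w) (p : Config L)
    (x : M) (v : Fin 2 → TangentSpace 𝓘(ℝ, ℂ) x) : (momentMap w p x v).re = 0 := by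
  have h1 := p.A.curvature_re x v
  have h2 := hw.im_eq_zero x v
  change (p.A.curvature x v - (Complex.I * (spinorNormSq p x / 2 : ℝ)) * w x v).re = 0
  simp [h1, h2]

theorem rePair_add_smul (Ψ β : Sec L × Sec L) (t : ℝ) (x : M) :
    rePair (Ψ + t • β) (Ψ + t • β) x =
      rePair Ψ Ψ x + 2 * t * rePair Ψ β x + t ^ 2 * rePair β β x := by
  have h : ∀ s r : Sec L, ‖(s + t • r) x‖ ^ 2 =
      ‖s x‖ ^ 2 + 2 * t * (inner ℂ (r x) (s x)).re + t ^ 2 * ‖r x‖ ^ 2 := fun s r => by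
    change ‖s x + t • r x‖ ^ 2 = _
    have hsymm : (inner ℂ (r x) (s x)).re = (inner ℂ (s x) (r x)).re :=
      inner_re_symm (𝕜 := ℂ) (r x) (s x)
    rw [hsymm, ← Complex.coe_smul, norm_add_sq (𝕜 := ℂ), inner_smul_right, norm_smul]
    simp [mul_pow]
    ring
  rw [rePair_self, rePair_self, rePair_self]
  have h1 := h Ψ.1 β.1
  have h2 := h Ψ.2 β.2
  change ‖(Ψ.1 + t • β.1) x‖ ^ 2 + ‖(Ψ.2 + t • β.2) x‖ ^ 2 = _
  rw [h1, h2, rePair, hermPair, Complex.add_re]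
  ring

end MomentMap

/-! ### The Hamiltonian -/

section Hamiltonian

variable {M : Type*} [TopologicalSpace M] [T2Space M] [CompactSpace M] [ChartedSpace ℂ M]

section Real

variable [IsManifold 𝓘(ℝ, ℂ) ∞ M]

/-- The integral of a real two-form is real. -/
theorem integral_eq_ofReal {η : TwoForm M}
    (h : ∀ p, ∀ z ∈ (chartAt ℂ p).target, (density p η z).im = 0) :
    integral η = ((∑ p ∈ partitionIndex M, ∫ z in (chartAt ℂ p).target,
      chartPartition M p ((chartAt ℂ p).symm z) * (density p η z).re : ℝ) : ℂ) := by
  rw [integral_eq_sum, Complex.ofReal_sum]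
  refine Finset.sum_congr rfl fun p _ => ?_
  rw [← integral_complex_ofReal]
  refine setIntegral_congr_fun (chartAt ℂ p).open_target.measurableSet fun z hz => ?_
  have h1 : density p η z = ((density p η z).re : ℂ) := by
    conv_lhs => rw [← Complex.re_add_im (density p η z), h p z hz]
    simp
  simp only [Complex.ofReal_mul]
  rw [← h1]

/-- A nonnegative smooth two-form with vanishing integral vanishes. -/
theorem eq_zero_of_integral_eq_zero {η : TwoForm M} (hη : η.IsSmooth)
    (him : ∀ p, ∀ z ∈ (chartAt ℂ p).target, (density p η z).im = 0)
    (hre : ∀ p, ∀ z ∈ (chartAt ℂ p).target, 0 ≤ (density p η z).re)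
    (h0 : integral η = 0) : η = 0 := by
  rw [integral_eq_ofReal him, Complex.ofReal_eq_zero] at h0
  have hnn : ∀ p : M, ∀ z ∈ (chartAt ℂ p).target,
      0 ≤ chartPartition M p ((chartAt ℂ p).symm z) * (density p η z).re := fun p z hz =>
    mul_nonneg ((chartPartition M).nonneg _ _) (hre p z hz)
  -- Each chart contributes a nonnegative number, so every contribution vanishes.
  have h1 := (Finset.sum_eq_zero_iff_of_nonneg fun p _ =>
    setIntegral_nonneg (chartAt ℂ p).open_target.measurableSet (hnn p)).1 h0
  funext x
  obtain ⟨p, hp⟩ : ∃ p, chartPartition M p x ≠ 0 := by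
    obtain ⟨p, hp⟩ := (chartPartition M).exists_pos_of_mem (mem_univ x)
    exact ⟨p, hp.ne'⟩
  have hxp : x ∈ (chartAt ℂ p).source := by
    by_contra h
    exact hp (chartPartition_eq_zero h)
  have hpi : p ∈ partitionIndex M := by
    by_contra h
    exact hp (chartPartition_of_notMem h x)
  obtain ⟨hc1, hc2⟩ := isCompact_image_chart (isClosed_tsupport (chartPartition M p))
    (tsupport_chartPartition_subset p)
  have hU := (chartAt ℂ p).open_target
  obtain ⟨h2, h3⟩ := contDiff_indicator (n := ∞) hU hc1 hc2
    (h := fun z => chartPartition M p ((chartAt ℂ p).symm z) * (density p η z).re)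
    (fun z hz hzK => by
      rw [image_eq_zero_of_notMem_tsupport (symm_notMem_of_notMem_image hz hzK), zero_mul])
    ((contDiffOn_comp_symm (chartPartition M p).contMDiff p).mul
      (Complex.reCLM.contDiff.comp_contDiffOn (hη p)))
  have h4 := h1 p hpi
  rw [← integral_indicator hU.measurableSet] at h4
  have hz : chartAt ℂ p x ∈ (chartAt ℂ p).target := (chartAt ℂ p).map_source hxp
  have h5 : chartPartition M p ((chartAt ℂ p).symm (chartAt ℂ p x)) *
      (density p η (chartAt ℂ p x)).re = 0 := by
    -- The integrand, extended by zero, is continuous, nonnegative and compactly supported on the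
    -- plane; a nonzero value would make its integral positive.
    by_contra hne
    refine (h2.continuous.integral_pos_of_hasCompactSupport_nonneg_nonzero (μ := volume) h3
      (fun z => indicator_nonneg (hnn p) z) (x := chartAt ℂ p x) ?_).ne' h4
    rwa [indicator_of_mem hz]
  rw [(chartAt ℂ p).left_inv hxp] at h5
  have h6 : density p η (chartAt ℂ p x) = 0 :=
    Complex.ext ((mul_eq_zero.1 h5).resolve_left hp) (him p _ hz)
  -- The vanishing was obtained in a chart at `p` with `ρ_p(x) ≠ 0`; it is carried to the chart at
  -- `x`, whose centre determines the form at `x`.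
  have h7 : chartAt ℂ x x ∈ (transition x p).source :=
    mem_transition_source.2 ⟨mem_chart_target ℂ x, by
      rwa [(chartAt ℂ x).left_inv (mem_chart_source ℂ x)]⟩
  refine twoForm_eq_of_density (η' := 0) ?_
  rw [density_congr h7, transition_apply, (chartAt ℂ x).left_inv (mem_chart_source ℂ x), h6,
    mul_zero]
  rfl

variable {L : M → Type*} [TopologicalSpace (TotalSpace ℂ L)] [∀ x, NormedAddCommGroup (L x)]
  [∀ x, InnerProductSpace ℂ (L x)] [FiberBundle ℂ L] [VectorBundle ℂ ℂ L]
  [ContMDiffVectorBundle ∞ ℂ L 𝓘(ℝ, ℂ)] [IsSmoothHermitian L]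

theorem isSmooth_smul_momentMap {w : TwoForm M} (hw : IsAreaForm w) (ζ : ImFun M) (p : Config L) :
    TwoForm.IsSmooth
      (fun x => (ζ : C^∞⟮𝓘(ℝ, ℂ), M; 𝓘(ℝ, ℂ), ℂ⟯) x • momentMap w p x) :=
  (isSmooth_momentMap hw.smooth p).smul ζ.1.contMDiff

theorem hamiltonian_im {w : TwoForm M} (hw : IsAreaForm w) (ζ : ImFun M) (p : Config L) :
    (hamiltonian w ζ p).im = 0 := by
  rw [hamiltonian, integral_eq_ofReal, Complex.ofReal_im]
  intro q z _
  have h1 := ζ.2 ((chartAt ℂ q).symm z)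
  have h2 : (density q (momentMap w p) z).re = 0 := momentMap_re hw p _ _
  change (_ * density q (momentMap w p) z).im = 0
  rw [Complex.mul_im, h1, h2]
  simp

theorem isLinearMap_hamiltonian {w : TwoForm M} (hw : IsAreaForm w) (p : Config L) :
    IsLinearMap ℝ (fun ζ : ImFun M => hamiltonian w ζ p) where
  map_add ζ ζ' := by
    rw [hamiltonian, hamiltonian, hamiltonian, ← integral_add (isSmooth_smul_momentMap hw ζ p)
      (isSmooth_smul_momentMap hw ζ' p)]
    congr 1
    funext x
    exact add_smul (M := ℂ [⋀^Fin 2]→L[ℝ] ℂ) _ _ (momentMap w p x)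
  map_smul c ζ := by
    rw [hamiltonian, hamiltonian, Complex.real_smul, ← integral_const_smul]
    congr 1
    funext x
    change (c • (ζ : C^∞⟮𝓘(ℝ, ℂ), M; 𝓘(ℝ, ℂ), ℂ⟯) x) • momentMap w p x = _
    rw [Complex.real_smul]
    exact mul_smul (β := ℂ [⋀^Fin 2]→L[ℝ] ℂ) _ _ (momentMap w p x)

theorem curvatureEq_iff (w : TwoForm M) (p : Config L) :
    CurvatureEq w p ↔ momentMap w p = 0 :=
  ⟨fun h => funext fun x => sub_eq_zero.2 (h x), fun h x => sub_eq_zero.1 (congrFun h x)⟩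

/-! ### Division by the area form and the zero level of the moment map -/

theorem IsAreaForm.density_ne_zero {w : TwoForm M} (hw : IsAreaForm w) {p : M} {z : ℂ}
    (hz : z ∈ (chartAt ℂ p).target) : density p w z ≠ 0 := by
  obtain ⟨r, hr, h⟩ := hw.pos p z hz
  rw [h]
  exact Complex.ofReal_ne_zero.2 hr.ne'

/-- The quotient of a two-form by an area form. -/
def ratio (η w : TwoForm M) (x : M) : ℂ :=
  density x η (chartAt ℂ x x) / density x w (chartAt ℂ x x)

/-- Both densities acquire the same Jacobian factor, which is nonzero because the density of `w` is;
it cancels. Hence the pointwise quotient is a smooth global function. -/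
theorem ratio_chart {w : TwoForm M} (hw : IsAreaForm w) (η : TwoForm M) {p : M} {z : ℂ}
    (hz : z ∈ (chartAt ℂ p).target) :
    ratio η w ((chartAt ℂ p).symm z) = density p η z / density p w z := by
  have hs := chart_symm_mem_source hz _ rfl
  have h1 := hw.density_ne_zero hz
  rw [density_congr hs] at h1
  rw [density_congr hs η, density_congr hs w, mul_div_mul_left _ _ (left_ne_zero_of_mul h1)]
  rfl

theorem contMDiff_ratio {w : TwoForm M} (hw : IsAreaForm w) {η : TwoForm M} (hη : η.IsSmooth) :
    ContMDiff 𝓘(ℝ, ℂ) 𝓘(ℝ, ℂ) ∞ (ratio η w) := by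
  intro x
  refine contMDiffAt_of_comp_symm (mem_chart_source ℂ x) ?_
  have hU := (chartAt ℂ x).open_target.mem_nhds (mem_chart_target ℂ x)
  have h1 : ContDiffAt ℝ ∞ (fun z => density x η z / density x w z) (chartAt ℂ x x) :=
    ((hη x).contDiffAt hU).mul ((contDiffAt_inv ℝ (hw.density_ne_zero
      (mem_chart_target ℂ x))).comp _ ((hw.smooth x).contDiffAt hU))
  refine h1.congr_of_eventuallyEq ?_
  filter_upwards [hU] with z hz
  exact ratio_chart hw η hz

theorem momentMap_eq_zero_of_hamiltonian {w : TwoForm M} (hw : IsAreaForm w) (p : Config L)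
    (h : ∀ ζ : ImFun M, hamiltonian w ζ p = 0) : momentMap w p = 0 := by
  set η := momentMap w p with hη
  have hs : η.IsSmooth := isSmooth_momentMap hw.smooth p
  have hr : ∀ q, ∀ z ∈ (chartAt ℂ q).target, ∃ r d : ℝ, 0 < r ∧ density q w z = r ∧
      density q η z = d * Complex.I ∧
      ratio η w ((chartAt ℂ q).symm z) = ((d / r : ℝ) : ℂ) * Complex.I := fun q z hz => by
    obtain ⟨r, hr, h1⟩ := hw.pos q z hz
    have h2 : (density q η z).re = 0 := momentMap_re hw p _ _
    have h3 : density q η z = ((density q η z).im : ℂ) * Complex.I := by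
      conv_lhs => rw [← Complex.re_add_im (density q η z), h2]
      simp
    refine ⟨r, (density q η z).im, hr, h1, h3, ?_⟩
    rw [ratio_chart hw η hz, h1]
    conv_lhs => rw [h3]
    push_cast
    ring
  have hD := (contDiff_neg (𝕜 := ℝ) (F := ℂ) (n := ∞)).contMDiff.comp (contMDiff_ratio hw hs)
  -- The test function is `-μ/ω`. It is admissible because `μ` is imaginary and `ω` real; with
  -- densities `i d` and `r`, the density of `ζμ` is `-(i d / r)(i d) = d² / r ≥ 0`.
  let ζ : ImFun M := ⟨⟨fun x => -ratio η w x, hD⟩, fun x => by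
    obtain ⟨r, d, _, _, _, h4⟩ := hr x _ (mem_chart_target ℂ x)
    rw [(chartAt ℂ x).left_inv (mem_chart_source ℂ x)] at h4
    change (-ratio η w x).re = 0
    rw [h4]
    simp⟩
  have hdens : ∀ q, ∀ z ∈ (chartAt ℂ q).target, ∃ s : ℝ, 0 ≤ s ∧
      density q (fun x => (ζ : C^∞⟮𝓘(ℝ, ℂ), M; 𝓘(ℝ, ℂ), ℂ⟯) x • η x) z = s ∧
      (s = 0 → density q η z = 0) := fun q z hz => by
    obtain ⟨r, d, hr0, _, h3, h4⟩ := hr q z hz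
    refine ⟨d ^ 2 / r, by positivity, ?_, fun hs => ?_⟩
    · change -ratio η w ((chartAt ℂ q).symm z) * density q η z = _
      rw [h3, h4]
      push_cast
      linear_combination (-(d : ℂ) ^ 2 / r) * Complex.I_mul_I
    · have h5 : d = 0 := by
        rcases div_eq_zero_iff.1 hs with h5 | h5
        · exact pow_eq_zero_iff two_ne_zero |>.1 h5
        · exact absurd h5 hr0.ne'
      rw [h3, h5]
      simp
  have h0 := eq_zero_of_integral_eq_zero (isSmooth_smul_momentMap hw ζ p)
    (fun q z hz => by
      obtain ⟨s, _, h1, _⟩ := hdens q z hz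
      exact (congrArg Complex.im h1).trans (Complex.ofReal_im s))
    (fun q z hz => by
      obtain ⟨s, h0, h1, _⟩ := hdens q z hz
      exact h0.trans_eq ((congrArg Complex.re h1).trans (Complex.ofReal_re s)).symm) (h ζ)
  funext x
  refine twoForm_eq_of_density (η' := 0) ?_
  obtain ⟨s, _, h1, h2⟩ := hdens x _ (mem_chart_target ℂ x)
  refine h2 ?_
  rw [← Complex.ofReal_eq_zero, ← h1]
  refine density_eq_zero ?_
  exact congrFun h0 _

end Real

/-! ### The first variation and Hamilton's equation -/

variable [IsManifold 𝓘(ℂ, ℂ) ω M]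
  {L : M → Type*} [TopologicalSpace (TotalSpace ℂ L)] [∀ x, NormedAddCommGroup (L x)]
  [∀ x, InnerProductSpace ℂ (L x)] [FiberBundle ℂ L] [VectorBundle ℂ ℂ L]
  [ContMDiffVectorBundle ∞ ℂ L 𝓘(ℝ, ℂ)] [IsSmoothHermitian L]

theorem extD_const_smul (c : ℝ) (α : OneForm M) (x : M) :
    extD (fun y => (c • α) y) x = (c : ℂ) • extD (fun y => α y) x := by
  have h := extD_smul (f := fun _ => (c : ℂ)) contMDiffAt_const (α.smoothFormAt x)
  rw [mvfderiv_const] at h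
  have h1 : (fun y => (c • α) y) = fun y => (c : ℂ) • α y := by
    funext y
    ext v
    change c • α y v = (c : ℂ) • α y v
    rw [Complex.coe_smul]
  have h2 : wedgeAt (0 : TangentSpace 𝓘(ℝ, ℂ) x →L[ℝ] ℂ) (α x) = 0 := by
    ext v
    change 0 * α x (v 1) - 0 * α x (v 0) = 0
    simp
  rw [h1, h, h2, zero_add]

/-- The first variation of the moment map. -/
def momentVariation (w : TwoForm M) (p : Config L) (X : TangentVec L) : TwoForm M := fun x =>
  extD (fun y => (X.1 : OneForm M) y) x - (Complex.I * (rePair p.Ψ X.2.1 x : ℂ)) • w x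

/-- An exact expansion with no remainder: the curvature is affine along a line in `𝒞` and the spinor
norm is quadratic. -/
theorem momentMap_translate (w : TwoForm M) (p : Config L) (X : TangentVec L) (t : ℝ) (x : M) :
    momentMap w (p.translate (t • X)) x = momentMap w p x +
      ((t : ℂ) • momentVariation w p X x +
        ((t ^ 2 : ℝ) : ℂ) • (-(Complex.I / 2) * (rePair X.2.1 X.2.1 x : ℂ)) • w x) := by
  have h1 : (p.translate (t • X)).A.curvature x =
      p.A.curvature x + (t : ℂ) • extD (fun y => (X.1 : OneForm M) y) x :=
    (p.A.curvature_addForm _ x).trans (congrArg _ (extD_const_smul t _ x))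
  have h2 := rePair_add_smul p.Ψ X.2.1 t x
  have h3 : (p.translate (t • X)).Ψ = p.Ψ + t • X.2.1 := rfl
  have key : ∀ (F D W : ℂ [⋀^Fin 2]→L[ℝ] ℂ) (a b c : ℝ),
      F + (t : ℂ) • D - (Complex.I / 2 * ((a + 2 * t * b + t ^ 2 * c : ℝ) : ℂ)) • W =
      F - (Complex.I / 2 * (a : ℂ)) • W + ((t : ℂ) • (D - (Complex.I * (b : ℂ)) • W) +
        ((t ^ 2 : ℝ) : ℂ) • (-(Complex.I / 2) * (c : ℂ)) • W) := fun F D W a b c => by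
    ext v
    change F v + (t : ℂ) * D v - (Complex.I / 2 * ((a + 2 * t * b + t ^ 2 * c : ℝ) : ℂ)) * W v =
      F v - (Complex.I / 2 * (a : ℂ)) * W v + ((t : ℂ) * (D v - (Complex.I * (b : ℂ)) * W v) +
        ((t ^ 2 : ℝ) : ℂ) * (-(Complex.I / 2) * (c : ℂ) * W v))
    push_cast
    ring
  rw [momentMap_eq, momentMap_eq]
  simp only [h1, h3, h2]
  exact key _ _ _ _ _ _

/-- Stokes' theorem moves the derivative from `α` to `ζ`; the spinor terms agree pointwise and need
no integration. -/
theorem sympForm_infGauge {w : TwoForm M} (hw : IsAreaForm w) (ζ : ImFun M) (p : Config L)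
    (X : TangentVec L) : sympForm w (infGauge ζ p) X =
      integral (fun x => (ζ : C^∞⟮𝓘(ℝ, ℂ), M; 𝓘(ℝ, ℂ), ℂ⟯) x • momentVariation w p X x) := by
  set f : M → ℂ := fun x => (ζ : C^∞⟮𝓘(ℝ, ℂ), M; 𝓘(ℝ, ℂ), ℂ⟯) x with hf
  have hfs : ContMDiff 𝓘(ℝ, ℂ) 𝓘(ℝ, ℂ) ∞ f := ζ.1.contMDiff
  have hsd : TwoForm.IsSmooth (extD fun y => (X.1 : OneForm M) y) :=
    isSmooth_extD (OneForm.smoothFormAt _)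
  -- The sum is the integral of `d(ζα) = dζ ∧ α + ζ dα`.
  have h1 : integral (wedge (dIm ζ : OneForm M) X.1) +
      integral (fun x => f x • extD (fun y => (X.1 : OneForm M) y) x) = 0 := by
    rw [← integral_add (isSmooth_wedge _ _) (hsd.smul hfs),
      ← integral_extD (smulForm hfs (X.1 : OneForm M))]
    congr 1
    funext x
    exact (extD_smul (hfs x) (OneForm.smoothFormAt _ x)).symm
  have h2 : integral (wedge ((infGauge ζ p).2.2 : OneForm M) X.2.2) = 0 := by
    rw [← integral_zero (M := M)]
    congr 1
    funext x
    ext v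
    change 0 * _ - 0 * _ = (0 : ℂ)
    simp
  have h3 : ∀ x, (hermPair (mulI (infGauge ζ p).2.1) X.2.1 x).re =
      ((f x).im) * rePair p.Ψ X.2.1 x := fun x => by
    -- Since `ζ = i Im ζ`, the factor `i · (-ζ)` is the real number `Im ζ`, which passes through the
    -- real part.
    have h4 : ∀ s r : Sec L, inner ℂ (r x)
        (Complex.I • (-(f x • s x))) = ((f x).im : ℂ) * inner ℂ (r x) (s x) := fun s r => by
      have h5 : f x = ((f x).im : ℂ) * Complex.I := imFun_eq_im_mul_I ζ x
      rw [inner_smul_right, inner_neg_right, inner_smul_right]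
      linear_combination (-Complex.I * inner ℂ (r x) (s x)) * h5 -
        (((f x).im : ℂ) * inner ℂ (r x) (s x)) * Complex.I_mul_I
    rw [rePair, ← Complex.re_ofReal_mul]
    congr 1
    refine (congrArg₂ (· + ·) (h4 p.Ψ.1 X.2.1.1) (h4 p.Ψ.2 X.2.1.2)).trans ?_
    rw [hermPair, mul_add]
  have h5 : integral (fun x => f x • momentVariation w p X x) =
      integral (fun x => f x • extD (fun y => (X.1 : OneForm M) y) x) +
      integral (fun x => ((hermPair (mulI (infGauge ζ p).2.1) X.2.1 x).re : ℂ) • w x) := by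
    have hs : TwoForm.IsSmooth
        (fun x => ((hermPair (mulI (infGauge ζ p).2.1) X.2.1 x).re : ℂ) • w x) := by
      have h6 := contMDiff_rePair (L := L) 1 (mulI (infGauge ζ p).2.1) X.2.1
      simp only [one_mul] at h6
      exact hw.smooth.smul h6
    rw [← integral_add (hsd.smul hfs) hs]
    congr 1
    funext x
    rw [h3 x]
    have key : ∀ (D W : ℂ [⋀^Fin 2]→L[ℝ] ℂ) (a b : ℝ),
        ((a : ℂ) * Complex.I) • (D - (Complex.I * (b : ℂ)) • W) =
          ((a : ℂ) * Complex.I) • D + ((a * b : ℝ) : ℂ) • W := fun D W a b => by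
      ext v
      change ((a : ℂ) * Complex.I) * (D v - (Complex.I * (b : ℂ)) * W v) =
        ((a : ℂ) * Complex.I) * D v + ((a * b : ℝ) : ℂ) * W v
      push_cast
      linear_combination (-(a : ℂ) * b * W v) * Complex.I_mul_I
    have h7 : f x = ((f x).im : ℂ) * Complex.I := imFun_eq_im_mul_I ζ x
    conv_lhs => rw [h7]
    conv_rhs =>
      enter [1]
      rw [h7]
    exact key _ _ _ _
  rw [h5, sympForm, h2, sub_zero]
  have h8 : integral (wedge ((infGauge ζ p).1 : OneForm M) X.1) =
    -integral (fun x => f x • extD (fun y => (X.1 : OneForm M) y) x) := eq_neg_of_add_eq_zero_left h1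
  rw [h8, neg_neg]

theorem hasDerivAt_hamiltonian {w : TwoForm M} (hw : IsAreaForm w) (ζ : ImFun M) (p : Config L)
    (X : TangentVec L) : HasDerivAt (fun t : ℝ => hamiltonian w ζ (p.translate (t • X)))
      (sympForm w (infGauge ζ p) X) 0 := by
  set f : M → ℂ := fun x => (ζ : C^∞⟮𝓘(ℝ, ℂ), M; 𝓘(ℝ, ℂ), ℂ⟯) x with hf
  have hfs : ContMDiff 𝓘(ℝ, ℂ) 𝓘(ℝ, ℂ) ∞ f := ζ.1.contMDiff
  have hcs : ∀ (c : ℂ) {η : TwoForm M}, η.IsSmooth → TwoForm.IsSmooth (fun x => c • η x) :=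
    fun c η h => h.smul (f := fun _ => c) contMDiff_const
  set B : TwoForm M := fun x => f x • momentVariation w p X x with hB
  set C : TwoForm M := fun x =>
    f x • (-(Complex.I / 2) * (rePair X.2.1 X.2.1 x : ℂ)) • w x with hC
  have hBs : B.IsSmooth := TwoForm.IsSmooth.smul hfs
    ((isSmooth_extD (OneForm.smoothFormAt (X.1 : OneForm M))).sub
      (hw.smooth.smul (contMDiff_rePair Complex.I p.Ψ X.2.1)))
  have hCs : C.IsSmooth := TwoForm.IsSmooth.smul hfs
    (hw.smooth.smul (contMDiff_rePair (-(Complex.I / 2)) X.2.1 X.2.1))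
  -- The integral is split into the coefficients of `1`, `t` and `t²`; smoothness of each piece
  -- supplies the integrability. Only the coefficient of `t` survives in the derivative at `0`.
  have h1 : ∀ t : ℝ, hamiltonian w ζ (p.translate (t • X)) =
      hamiltonian w ζ p + ((t : ℂ) * integral B + ((t ^ 2 : ℝ) : ℂ) * integral C) := fun t => by
    rw [← integral_const_smul, ← integral_const_smul,
      ← integral_add (hcs _ hBs) (hcs _ hCs), hamiltonian, hamiltonian,
      ← integral_add (isSmooth_smul_momentMap hw ζ p) ((hcs _ hBs).add (hcs _ hCs))]
    congr 1
    funext x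
    rw [momentMap_translate]
    have key : ∀ (F D W : ℂ [⋀^Fin 2]→L[ℝ] ℂ) (a b c : ℂ),
        a • (F + (b • D + c • W)) = a • F + (b • a • D + c • a • W) := fun F D W a b c => by
      rw [smul_add, smul_add, smul_comm a b, smul_comm a c]
    exact key _ _ _ _ _ _
  have h2 : (fun t : ℝ => hamiltonian w ζ (p.translate (t • X))) = fun t : ℝ =>
      hamiltonian w ζ p + ((t : ℂ) * integral B + ((t ^ 2 : ℝ) : ℂ) * integral C) := funext h1
  have h3 : HasDerivAt (fun t : ℝ => (t : ℂ)) 1 0 := Complex.ofRealCLM.hasDerivAt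
  have h4 : HasDerivAt (fun t : ℝ => ((t ^ 2 : ℝ) : ℂ)) 0 0 := by
    simpa using (hasDerivAt_pow 2 (0 : ℝ)).ofReal_comp
  have h5 := ((h3.mul_const (integral B)).add (h4.mul_const (integral C))).const_add
    (hamiltonian w ζ p)
  rw [h2, sympForm_infGauge hw]
  simpa using h5

end Hamiltonian

end GaugeSurface

end

/-- The action of the gauge group on the configuration space of a Hermitian line bundle over a compact
Riemann surface has `μ = F_A - i (|ψ₁|² + |ψ₂|²) / 2 ω` as a moment map for `Ω`, and the curvature
equation is its zero level. -/
theorem proposition3p2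
    {M : Type*} [TopologicalSpace M] [T2Space M] [CompactSpace M] [ConnectedSpace M]
    [ChartedSpace ℂ M] [IsManifold 𝓘(ℂ, ℂ) ω M]
    {L : M → Type*} [TopologicalSpace (TotalSpace ℂ L)] [∀ x, NormedAddCommGroup (L x)]
    [∀ x, InnerProductSpace ℂ (L x)] [FiberBundle ℂ L] [VectorBundle ℂ ℂ L]
    [ContMDiffVectorBundle ∞ ℂ L 𝓘(ℝ, ℂ)] [GaugeSurface.IsSmoothHermitian L]
    (w : GaugeSurface.TwoForm M) (hw : GaugeSurface.IsAreaForm w) :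
    -- `X_ζ` is the infinitesimal generator of the gauge action
    (∀ (ζ : GaugeSurface.ImFun M) (p : GaugeSurface.Config L),
      GaugeSurface.HasVelocity
        (fun t : ℝ => GaugeSurface.gaugeAct (GaugeSurface.expGauge (t • ζ)) p)
        (GaugeSurface.infGauge ζ p)) ∧
    -- `X_ζ` is Hamiltonian with Hamiltonian `H_ζ`: `dH_ζ(X) = Ω(X_ζ, X)`
    (∀ (ζ : GaugeSurface.ImFun M) (p : GaugeSurface.Config L) (X : GaugeSurface.TangentVec L),
      HasDerivAt (fun t : ℝ => GaugeSurface.hamiltonian w ζ (p.translate (t • X)))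
        (GaugeSurface.sympForm w (GaugeSurface.infGauge ζ p) X) 0) ∧
    -- `H_ζ` is real valued and linear in `ζ`
    (∀ (ζ : GaugeSurface.ImFun M) (p : GaugeSurface.Config L),
      (GaugeSurface.hamiltonian w ζ p).im = 0) ∧
    (∀ p : GaugeSurface.Config L,
      IsLinearMap ℝ (fun ζ : GaugeSurface.ImFun M => GaugeSurface.hamiltonian w ζ p)) ∧
    -- `μ` takes values in `Ω²(M, iℝ)` and is invariant under the gauge group
    (∀ p : GaugeSurface.Config L, (GaugeSurface.momentMap w p).IsSmooth ∧
      ∀ x v, (GaugeSurface.momentMap w p x v).re = 0) ∧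
    (∀ (u : GaugeSurface.GaugeGroup M) (p : GaugeSurface.Config L),
      GaugeSurface.momentMap w (GaugeSurface.gaugeAct u p) = GaugeSurface.momentMap w p) ∧
    -- the curvature equation is the zero level of `μ`, both as a two-form and as an element
    -- of the dual of the Lie algebra
    (∀ p : GaugeSurface.Config L,
      (GaugeSurface.CurvatureEq w p ↔ GaugeSurface.momentMap w p = 0) ∧
      (GaugeSurface.CurvatureEq w p ↔
        ∀ ζ : GaugeSurface.ImFun M, GaugeSurface.hamiltonian w ζ p = 0)) := by
  exact ⟨GaugeSurface.hasVelocity_gaugeAct, GaugeSurface.hasDerivAt_hamiltonian hw,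
    GaugeSurface.hamiltonian_im hw, GaugeSurface.isLinearMap_hamiltonian hw,
    fun p => ⟨GaugeSurface.isSmooth_momentMap hw.smooth p, GaugeSurface.momentMap_re hw p⟩,
    GaugeSurface.momentMap_gaugeAct w,
    fun p => ⟨GaugeSurface.curvatureEq_iff w p, (GaugeSurface.curvatureEq_iff w p).trans
      ⟨fun h ζ => by
        rw [GaugeSurface.hamiltonian, h, ← GaugeSurface.integral_zero (M := M)]
        congr 1
        funext x
        exact smul_zero (M := ℂ) (A := ℂ [⋀^Fin 2]→L[ℝ] ℂ) _,
      GaugeSurface.momentMap_eq_zero_of_hamiltonian hw p⟩⟩⟩
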